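/- Let $|n\rangle$ ($n\ge 0$) be the number states of the harmonic oscillator, let $a|n\rangle=\sqrt n\,|n-1\rangle$ and $a^\dagger|n\rangle=\sqrt{n+1}\,|n+1\rangle$ act on their finite linear span $\mathcal D$, and let $X_\varphi=\tfrac12(a^\dagger e^{i\varphi}+ae^{-i\varphi})$. Let $H_n$ be the (physicists') Hermite polynomials and let $\delta(X_\varphi-x)=|x\rangle_\varphi\,{}_\varphi\langle x|$ be the quadrature projectors, i.e. the spectral density of $X_\varphi$, where $\langle n|x\rangle_\varphi=e^{i\varphi n}(2/\pi)^{1/4}(2^nn!)^{-1/2}H_n(\sqrt2x)e^{-x^2}$. For a function $f$ put $f(X_\varphi)=\int f(x)\,|x\rangle_\varphi\,{}_\varphi\langle x|\,dx$ (matrix elements between number states). Put $$g_{k,l}=\sum_{t=0}^{\min(k,l)}\frac{(-1)^t}{t!\sqrt{(k-t)!(l-t)!}}\,|k-t\rangle\langle l-t|,\qquad c_{k,l}(x)=\binom{k+l}{k}^{-1}2^{-(k+l)/2}H_{k+l}(\sqrt2x).$$ Operators are understood through their matrix elements between number states (as sesquilinear forms on $\mathcal D$). Traces $\mathrm{Tr}[MA]=\sum_{i,j}M_{ij}A_{ji}$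 are ordinary ones when $M$ or $A$ has finitely many nonzero matrix elements. We say that $\mathrm{Tr}[MA]=L$ in the sense of Abel if $\sum_{i,j}r^iM_{ij}A_{ji}$ converges absolutely for $0<r<1$ and tends to $L$ as $r\to1^-$. There is a family $G(x,\varphi)$, $x,\varphi\in\mathbb R$, such that: 1. $G(x,\varphi)=e^{i\varphi a^\dagger a}G(x,0)e^{-i\varphi a^\dagger a}$, and $G^\dagger(x,0)=\sum_{k,l\ge0}g_{k,l}\,c_{k,l}(x)$, every matrix element of the series being absolutely convergent. 2. For all $n,m\ge0$, $$\mathrm{Tr}[G^\dagger(x,\varphi)a^{\dagger n}a^m]=\binom{n+m}{n}^{-1}2^{-(n+m)/2}H_{n+m}(\sqrt2x)\,e^{i\varphi(m-n)},$$ both when the series $G^\dagger(x,\varphi)=\sum_{k,l}c_{k,l}(x)\,e^{i\varphi a^\dagger a}g_{k,l}e^{-i\varphi a^\dagger a}$ is traced term by term and in the sense of Abel. 3. Let $f_{n,m}(x,\varphi)$ denote the right-hand side in 2. Then for every $\varphi$ $$\int_{-\infty}^{\infty}f_{n,m}(x,\varphi)\,\delta(X_\varphi-x)\,dx=\binom{n+m}{n}^{-1}2^{-(n+m)/2}H_{n+m}(\sqrt2X_\varphi)\,e^{i\varphi(m-n)},$$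 where the polynomial $H_{n+m}$ is evaluated at the operator $\sqrt2X_\varphi$ on $\mathcal D$, and Richter's expansion is reproduced: $$a^{\dagger n}a^m=\binom{n+m}{n}^{-1}\int_0^\pi\frac{d\varphi}{\pi}\,2^{-(n+m)/2}H_{n+m}(\sqrt2X_\varphi)\,e^{i\varphi(m-n)}$$ (equalities of matrix elements between number states, all integrals being absolutely convergent). 4. $G$ is a dual of the quadrature projectors, $\int_0^\pi\frac{d\varphi}\pi\int_{-\infty}^\infty dx\,|\delta(X_\varphi-x)\rangle\!\rangle\langle\!\langle G(x,\varphi)|=I\otimes I$: for all $p,q,i,j\ge0$, $$\int_0^\pi\frac{d\varphi}\pi\int_{-\infty}^\infty dx\,\langle p|\delta(X_\varphi-x)|q\rangle\,\overline{\langle i|G(x,\varphi)|j\rangle}=\delta_{pi}\delta_{qj},$$ with absolutely convergent integrals. 5. For all $x,\varphi$, $G(x,\varphi)$ is different from the canonical dual $K(x,\varphi)=\frac14\int_{-\infty}^\infty dk\,|k|\,e^{ik(X_\varphi-x)}$; and $K$ is divergent for unbounded operators, in that $\mathrm{Tr}[K^\dagger(x,\varphi)a^2]$ does not exist even in the sense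 of Abel. 6. The pattern functions of the matrix elements are, for all $i,j\ge0$, $$\mathrm{Tr}[G^\dagger(x,\varphi)|i\rangle\langle j|]=e^{i\varphi(j-i)}\sum_{t=0}^\infty\frac{(-1)^t}{t!\sqrt{i!\,j!}}\,c_{j+t,i+t}(x),$$ and in particular for the vacuum $$\mathrm{Tr}[G^\dagger(x,\varphi)|0\rangle\langle0|]=\sum_{k=0}^\infty\Big(-\frac12\Big)^k\frac{k!}{(2k)!}H_{2k}(\sqrt2x),$$ with absolutely convergent series. -/

import Mathlib

open MeasureTheory Filter Topology

noncomputable section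

/-- The span of the number (Fock) states `|0⟩, |1⟩, …` of the harmonic oscillator: the common
invariant dense domain on which `a`, `a†`, the quadratures and all polynomials in them act. -/
abbrev FockSpan : Type := ℕ →₀ ℂ

/-- The number state `|n⟩`. -/
def fockKet (n : ℕ) : FockSpan := Finsupp.single n 1

/-- `a |n⟩ = √n |n - 1⟩` (and `a |0⟩ = 0`, because `√0 = 0`). -/
def annihilation : Module.End ℂ FockSpan :=
  Finsupp.linearCombination ℂ fun n : ℕ => ((√(n : ℝ) : ℝ) : ℂ) • fockKet (n - 1)

/-- `a† |n⟩ = √(n + 1) |n + 1⟩`. -/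
def creation : Module.End ℂ FockSpan :=
  Finsupp.linearCombination ℂ fun n : ℕ => ((√((n : ℝ) + 1) : ℝ) : ℂ) • fockKet (n + 1)

/-- The quadrature `X_φ = (a† e^{iφ} + a e^{-iφ}) / 2`. -/
def quadrature (φ : ℝ) : Module.End ℂ FockSpan :=
  (1 / 2 : ℂ) • (Complex.exp (Complex.I * φ) • creation
    + Complex.exp (-(Complex.I * φ)) • annihilation)

/-- The Fock matrix `⟨p| A |q⟩`. General (possibly unbounded, or only form-valued) operators are
represented by their Fock matrix, an element of `Matrix ℕ ℕ ℂ`; the adjoint is `Mᴴ`. -/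
def fockMatrix (A : Module.End ℂ FockSpan) : Matrix ℕ ℕ ℂ :=
  Matrix.of fun p q => A (fockKet q) p

/-- `e^{iφ a†a} M e^{-iφ a†a}`, where `e^{iφ a†a} |n⟩ = e^{iφ n} |n⟩`. -/
def phaseRotate (φ : ℝ) (M : Matrix ℕ ℕ ℂ) : Matrix ℕ ℕ ℂ :=
  Matrix.of fun p q =>
    Complex.exp (Complex.I * φ * p) * M p q * Complex.exp (-(Complex.I * φ * q))

/-- The (physicists') Hermite polynomials `H_n`:
`H_0 = 1`, `H_{n+1}(y) = 2 y H_n(y) - H_n'(y)`. -/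
def hermiteH : ℕ → Polynomial ℝ
  | 0 => 1
  | n + 1 => 2 * Polynomial.X * hermiteH n - Polynomial.derivative (hermiteH n)

/-- `C(k+l,k)⁻¹ 2^{-(k+l)/2} H_{k+l}(√2 x)`. -/
def momentCoeff (k l : ℕ) (x : ℝ) : ℝ :=
  ((Nat.choose (k + l) k : ℕ) : ℝ)⁻¹ * (√((2 : ℝ) ^ (k + l)))⁻¹
    * (hermiteH (k + l)).eval (√2 * x)

/-- The dual set of the normally ordered moments,
`g_{k,l} = ∑_{t ≤ min(k,l)} (-1)^t / (t! √((k-t)! (l-t)!)) |k-t⟩⟨l-t|`. -/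
def momentDual (k l : ℕ) : Matrix ℕ ℕ ℂ :=
  ∑ t ∈ Finset.range (min k l + 1),
    ((((-1) ^ t / ((t.factorial : ℝ)
        * √(((k - t).factorial : ℝ) * ((l - t).factorial : ℝ))) : ℝ)) : ℂ)
      • Matrix.single (k - t) (l - t) (1 : ℂ)

/-- The real wave function `⟨n|x⟩₀ = (2/π)^{1/4} (2^n n!)^{-1/2} H_n(√2 x) e^{-x²}` of `|n⟩` in the
representation that diagonalizes `X_0 = (a + a†)/2`. -/
def waveFunction (n : ℕ) (x : ℝ) : ℝ :=
  (2 / Real.pi) ^ (1 / 4 : ℝ) / √((2 : ℝ) ^ n * (n.factorial : ℝ))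
    * (hermiteH n).eval (√2 * x) * Real.exp (-x ^ 2)

/-- `⟨n|x⟩_φ`, for the generalized eigenvector `|x⟩_φ = e^{iφ a†a} |x⟩₀` of `X_φ`. -/
def quadKet (x φ : ℝ) (n : ℕ) : ℂ :=
  Complex.exp (Complex.I * φ * n) * (waveFunction n x : ℂ)

/-- The quadrature projector `δ(X_φ - x) = |x⟩_φ φ⟨x|`, the spectral density of `X_φ`. -/
def quadProj (x φ : ℝ) : Matrix ℕ ℕ ℂ :=
  Matrix.of fun p q => quadKet x φ p * (starRingEnd ℂ) (quadKet x φ q)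

/-- `f(X_φ) = ∫ f(x) |x⟩_φ φ⟨x| dx`. -/
def quadFunction (φ : ℝ) (f : ℝ → ℂ) : Matrix ℕ ℕ ℂ :=
  Matrix.of fun p q => ∫ x : ℝ, f x * quadProj x φ p q

/-- The canonical dual of the quadrature projectors,
`(1/4) ∫ |k| e^{ik(X_φ - x)} dk`. -/
def canonicalDual (x φ : ℝ) : Matrix ℕ ℕ ℂ :=
  Matrix.of fun p q => (1 / 4 : ℂ) * ∫ k : ℝ, ((|k| : ℝ) : ℂ) * Complex.exp (-(Complex.I * k * x))
    * quadFunction φ (fun y => Complex.exp (Complex.I * k * y)) p q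

/-- `Tr[M A] = ∑_{i,j} M_{ij} A_{ji}`; used only where one of the two matrices has finitely many
nonzero entries. -/
def fockTrace (M A : Matrix ℕ ℕ ℂ) : ℂ := ∑' p : ℕ × ℕ, M p.1 p.2 * A p.2 p.1

/-- `Tr[M A] = L` in the sense of Abel: `Tr[r^{a†a} M A]` converges absolutely for `0 < r < 1`
and tends to `L` as `r → 1⁻`. -/
def HasAbelTrace (M A : Matrix ℕ ℕ ℂ) (L : ℂ) : Prop :=
  (∀ r : ℝ, 0 < r → r < 1 →
    Summable fun p : ℕ × ℕ => (r : ℂ) ^ p.1 * (M p.1 p.2 * A p.2 p.1)) ∧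
  Tendsto (fun r : ℝ => ∑' p : ℕ × ℕ, (r : ℂ) ^ p.1 * (M p.1 p.2 * A p.2 p.1))
    (𝓝[<] (1 : ℝ)) (𝓝 L)

/-- The estimator `C(n+m,n)⁻¹ 2^{-(n+m)/2} H_{n+m}(√2 x) e^{iφ(m-n)}` of `a†ⁿ aᵐ`. -/
def momentEstimator (n m : ℕ) (x φ : ℝ) : ℂ :=
  (momentCoeff n m x : ℂ) * Complex.exp (Complex.I * φ * ((m : ℂ) - (n : ℂ)))

/-- The operator `C(n+m,n)⁻¹ 2^{-(n+m)/2} H_{n+m}(√2 X_φ) e^{iφ(m-n)}`, with the polynomial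
`H_{n+m}` evaluated at the operator `√2 X_φ`. -/
def richterOperator (n m : ℕ) (φ : ℝ) : Module.End ℂ FockSpan :=
  (((((Nat.choose (n + m) n : ℕ) : ℝ)⁻¹ * (√((2 : ℝ) ^ (n + m)))⁻¹ : ℝ) : ℂ)
      * Complex.exp (Complex.I * φ * ((m : ℂ) - (n : ℂ))))
    • Polynomial.aeval (((√2 : ℝ) : ℂ) • quadrature φ) (hermiteH (n + m))

end

noncomputable section

/-! ### Hermite polynomials and the oscillator wave functions -/

/-! The normally ordered moments a†ⁿaᵐ and the matrices g_{k,l} form a biorthogonal and complete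
pair. Both facts come from one identity, ∑_t (-1)^t/(t!(K-t)!) = 0 for K > 0: it gives Tr[g_{k,l}
a†ⁿaᵐ] = δ_{km}δ_{ln} (`fockTrace_momentDual_moment`) and ∑_t (-1)^t/(t!√(i!j!)) a†^{i+t}a^{j+t} =
|i⟩⟨j| in matrix elements (`hasSum_momentDual_completeness`). A dual of the projectors is obtained
by pairing g_{k,l} with an estimator of the corresponding moment.

The estimator is Richter's. Since aa† = a†a + 1, normally ordered powers of c + d, with c = a†e^{iφ}
and d = ae^{-iφ}, obey the Hermite recurrence, so H_N(√2 X_φ) = 2^{N/2} :(c+d)^N: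
(`aeval_hermiteH_quadrature`). The phases of its binomial expansion are even harmonics, and
averaging over [0,π] isolates one moment. The generalized eigenvectors turn a polynomial in X_φ into
an integral over x (`integral_polynomial_mul_quadProj`). Integrating the series of G term by term
against the projectors and applying completeness yields the duality.

Convergence rests on c_{i+t,j+t}(x)/t! = (weight) · const · e^{x²}ψ_{i+j+2t}(x), where ψ_n is the
wave function: the weights decay with ratio 1/2, while ψ_n(x) grows more slowly than any exponential
ρⁿ, ρ > 1. The power series with these coefficients thus has radius at least 2. This justifies
regrouping the Abel trace for r < 1, where the binomial theorem produces ∑_N c_N (r-1)^N/N!, which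
tends to c_0.

For the canonical dual, the ladder relation yields the matrix elements of e^{ikX} in closed form
(`charElem_eq_ladderSum`), and their generating function is Gaussian. The substitution k = √(1-r)u
shows that the regularized trace with a² behaves like a nonzero constant over 1-r. Hence it
diverges, and K differs from G, whose trace converges. -/

lemma derivative_hermiteH_succ (n : ℕ) :
    Polynomial.derivative (hermiteH (n + 1)) = 2 * ((n : Polynomial ℝ) + 1) * hermiteH n := by
  induction n with
  | zero => simp [hermiteH]
  | succ n ih =>
    have h : hermiteH (n + 1 + 1)
        = 2 * Polynomial.X * hermiteH (n + 1) - 2 * ((n : Polynomial ℝ) + 1) * hermiteH n := by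
      rw [hermiteH, ih]
    have h1 : hermiteH (n + 1)
        = 2 * Polynomial.X * hermiteH n - Polynomial.derivative (hermiteH n) := by
      rw [hermiteH]
    rw [h]
    simp only [Polynomial.derivative_sub, Polynomial.derivative_mul, Polynomial.derivative_X,
      Polynomial.derivative_ofNat, Polynomial.derivative_natCast, Polynomial.derivative_add,
      Polynomial.derivative_one, ih, Nat.cast_add, Nat.cast_one]
    linear_combination (-2 * ((n : Polynomial ℝ) + 1)) * h1

/-- The derivative in the definition has no direct meaning at an operator argument; the three-term
form can be compared with `normalPow_succ_succ`. -/
lemma hermiteH_succ_succ (n : ℕ) :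
    hermiteH (n + 2)
      = 2 * Polynomial.X * hermiteH (n + 1) - 2 * ((n : Polynomial ℝ) + 1) * hermiteH n := by
  rw [hermiteH, derivative_hermiteH_succ]

/-- The normalization constant of the wave function of `|n⟩`. -/
def waveNorm (n : ℕ) : ℝ := (2 / Real.pi) ^ (1 / 4 : ℝ) / √((2 : ℝ) ^ n * (n.factorial : ℝ))

lemma waveNorm_succ (n : ℕ) : √2 * √((n : ℝ) + 1) * waveNorm (n + 1) = waveNorm n := by
  have h : √((2 : ℝ) ^ (n + 1) * ((n + 1).factorial : ℝ))
      = √2 * √((n : ℝ) + 1) * √((2 : ℝ) ^ n * (n.factorial : ℝ)) := by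
    rw [← Real.sqrt_mul (by positivity), ← Real.sqrt_mul (by positivity)]
    congr 1
    push_cast [Nat.factorial_succ]
    ring
  unfold waveNorm
  rw [h]
  have h1 : 0 < √2 := by positivity
  have h2 : 0 < √((n : ℝ) + 1) := by positivity
  have h3 : 0 < √((2 : ℝ) ^ n * (n.factorial : ℝ)) := by positivity
  field_simp

lemma waveFunction_eq (n : ℕ) (x : ℝ) :
    waveFunction n x = waveNorm n * (hermiteH n).eval (√2 * x) * Real.exp (-x ^ 2) := rfl

/-- This and the next lemma write both neighbours of ψ_n through H_n and H_n' alone, so that their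
sum gives multiplication by 2x and their difference the derivative. -/
lemma sqrt_succ_mul_waveFunction_succ (n : ℕ) (x : ℝ) :
    √((n : ℝ) + 1) * waveFunction (n + 1) x = waveNorm n
      * (2 * x * (hermiteH n).eval (√2 * x)
        - √2 / 2 * (Polynomial.derivative (hermiteH n)).eval (√2 * x)) * Real.exp (-x ^ 2) := by
  have h2 : √2 * √2 = 2 := Real.mul_self_sqrt (by norm_num)
  rw [waveFunction_eq, ← waveNorm_succ n, hermiteH]
  simp only [Polynomial.eval_sub, Polynomial.eval_mul, Polynomial.eval_X, Polynomial.eval_ofNat]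
  linear_combination (-(√((n : ℝ) + 1) * waveNorm (n + 1) * Real.exp (-x ^ 2)
    * (-(1/2) * (Polynomial.derivative (hermiteH n)).eval (√2 * x)))) * h2

lemma sqrt_mul_waveFunction_pred (n : ℕ) (x : ℝ) :
    √(n : ℝ) * waveFunction (n - 1) x = waveNorm n
      * (√2 / 2 * (Polynomial.derivative (hermiteH n)).eval (√2 * x)) * Real.exp (-x ^ 2) := by
  have h2 : √2 * √2 = 2 := Real.mul_self_sqrt (by norm_num)
  rcases n with _ | n
  · simp [hermiteH]
  · have h3 : √((n : ℝ) + 1) * √((n : ℝ) + 1) = (n : ℝ) + 1 := Real.mul_self_sqrt (by positivity)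
    rw [derivative_hermiteH_succ, Nat.add_sub_cancel, waveFunction_eq, ← waveNorm_succ n]
    simp only [Polynomial.eval_mul, Polynomial.eval_add, Polynomial.eval_natCast,
      Polynomial.eval_one, Polynomial.eval_ofNat, Nat.cast_add, Nat.cast_one]
    linear_combination (√2 * waveNorm (n + 1) * Real.exp (-x ^ 2)
      * (hermiteH n).eval (√2 * x)) * h3

lemma two_mul_self_mul_waveFunction (n : ℕ) (x : ℝ) :
    2 * x * waveFunction n x
      = √((n : ℝ) + 1) * waveFunction (n + 1) x + √(n : ℝ) * waveFunction (n - 1) x := by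
  rw [sqrt_succ_mul_waveFunction_succ, sqrt_mul_waveFunction_pred, waveFunction_eq]
  ring

lemma hasDerivAt_waveFunction (n : ℕ) (x : ℝ) :
    HasDerivAt (waveFunction n)
      (√(n : ℝ) * waveFunction (n - 1) x - √((n : ℝ) + 1) * waveFunction (n + 1) x) x := by
  have h1 : HasDerivAt (fun y : ℝ => √2 * y) (√2 * 1) x := (hasDerivAt_id x).const_mul _
  have h2 := ((hermiteH n).hasDerivAt (√2 * x)).comp x h1
  have h3 : HasDerivAt (fun y : ℝ => Real.exp (-y ^ 2)) (Real.exp (-x ^ 2) * (-(2 * x))) x := by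
    simpa using ((hasDerivAt_pow 2 x).neg).exp
  have h4 := (h2.const_mul (waveNorm n)).mul h3
  convert! h4 using 1
  rw [sqrt_succ_mul_waveFunction_succ, sqrt_mul_waveFunction_pred]
  simp only [Function.comp]
  ring

/-! ### Integrability against Gaussians -/

lemma exists_waveFunction_eq_polynomial (n : ℕ) :
    ∃ P : Polynomial ℝ, ∀ x, waveFunction n x = P.eval x * Real.exp (-x ^ 2) :=
  ⟨Polynomial.C (waveNorm n) * (hermiteH n).comp (Polynomial.C √2 * Polynomial.X), fun x => by
    simp [waveFunction_eq]⟩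

lemma integrable_polynomial_mul_gaussian (P : Polynomial ℝ) {b : ℝ} (hb : 0 < b) :
    Integrable fun x : ℝ => P.eval x * Real.exp (-b * x ^ 2) := by
  induction P using Polynomial.induction_on' with
  | add p q hp hq => simpa only [Polynomial.eval_add, add_mul, Pi.add_def] using hp.add hq
  | monomial n a =>
    have h := (integrable_rpow_mul_exp_neg_mul_sq hb (s := n)
      (by have : (0 : ℝ) ≤ n := n.cast_nonneg
          linarith)).const_mul a
    simpa [mul_assoc] using h

lemma integrable_polynomial_mul_waveFunction_mul (P : Polynomial ℝ) (p q : ℕ) :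
    Integrable fun x : ℝ => P.eval x * (waveFunction p x * waveFunction q x) := by
  obtain ⟨A, hA⟩ := exists_waveFunction_eq_polynomial p
  obtain ⟨B, hB⟩ := exists_waveFunction_eq_polynomial q
  refine (integrable_polynomial_mul_gaussian (P * A * B) (b := 2) (by norm_num)).congr
    (ae_of_all _ fun x => ?_)
  have : Real.exp (-2 * x ^ 2) = Real.exp (-x ^ 2) * Real.exp (-x ^ 2) := by
    rw [← Real.exp_add]; congr 1; ring
  simp only [Polynomial.eval_mul, hA, hB, this]
  ring

lemma integrable_waveFunction_mul (p q : ℕ) :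
    Integrable fun x : ℝ => waveFunction p x * waveFunction q x := by
  simpa using integrable_polynomial_mul_waveFunction_mul 1 p q

/-! ### Matrix elements of `e^{ikX}` -/

/-- `⟨p| e^{ikX_0} |q⟩`. -/
def charElem (p q : ℕ) (k : ℝ) : ℂ :=
  ∫ y : ℝ, Complex.exp (Complex.I * k * y) * ((waveFunction p y * waveFunction q y : ℝ) : ℂ)

lemma norm_cexp_I_mul_mul (k y : ℝ) : ‖Complex.exp (Complex.I * k * y)‖ = 1 := by
  rw [Complex.norm_exp]; simp

lemma integrable_cexp_mul_ofReal (k : ℝ) {f : ℝ → ℝ} (hf : Integrable f) :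
    Integrable fun y : ℝ => Complex.exp (Complex.I * k * y) * (f y : ℂ) := by
  refine hf.ofReal.bdd_mul (c := 1) (by fun_prop) (ae_of_all _ fun y => ?_)
  rw [norm_cexp_I_mul_mul]

lemma charElem_comm (p q : ℕ) (k : ℝ) : charElem p q k = charElem q p k := by
  simp [charElem, mul_comm]

/-- The commutator [a, e^{ikX}] = (ik/2) e^{ikX} in matrix elements, obtained by integrating by
parts. -/
lemma charElem_ladder (p q : ℕ) (k : ℝ) :
    (√((p : ℝ) + 1) : ℂ) * charElem (p + 1) q k
      = (√(q : ℝ) : ℂ) * charElem p (q - 1) k + (Complex.I * k / 2) * charElem p q k := by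
  set f : ℝ → ℝ := fun y => waveFunction p y * waveFunction q y with hf
  -- The derivative of ψ_pψ_q, with ψ_p' = 2yψ_p - 2√(p+1)ψ_{p+1} and ψ_q' = 2√q ψ_{q-1} - 2yψ_q;
  -- the terms in y cancel.
  set g : ℝ → ℝ := fun y => 2 * (√(q : ℝ) * (waveFunction p y * waveFunction (q - 1) y)
    - √((p : ℝ) + 1) * (waveFunction (p + 1) y * waveFunction q y)) with hg
  have hfi : Integrable f := integrable_waveFunction_mul p q
  have hgi : Integrable g := (((integrable_waveFunction_mul p (q - 1)).const_mul _).sub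
    ((integrable_waveFunction_mul (p + 1) q).const_mul _)).const_mul 2
  have hd : ∀ y, HasDerivAt (fun y : ℝ => ((f y : ℝ) : ℂ)) ((g y : ℝ) : ℂ) y := fun y => by
    refine HasDerivAt.ofReal_comp ?_
    convert! (hasDerivAt_waveFunction p y).mul (hasDerivAt_waveFunction q y) using 1
    have h1 := two_mul_self_mul_waveFunction p y
    have h2 := two_mul_self_mul_waveFunction q y
    simp only [hg]
    linear_combination waveFunction q y * h1 - waveFunction p y * h2
  have he : ∀ y : ℝ, HasDerivAt (fun y : ℝ => Complex.exp (Complex.I * k * y))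
      (Complex.I * k * Complex.exp (Complex.I * k * y)) y := fun y => by
    have h0 : HasDerivAt (fun z : ℂ => Complex.exp (Complex.I * k * z))
        (Complex.exp (Complex.I * k * y) * (Complex.I * k * 1)) y :=
      ((hasDerivAt_id (y : ℂ)).const_mul (Complex.I * k)).cexp
    have := h0.comp_ofReal
    convert! this using 1
    ring
  have key := integral_mul_deriv_eq_deriv_mul_of_integrable
    (fun y _ => he y) (fun y _ => hd y) (integrable_cexp_mul_ofReal k hgi)
    (by simpa only [mul_assoc, Pi.mul_def] using
      (integrable_cexp_mul_ofReal k hfi).const_mul (Complex.I * k))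
    (integrable_cexp_mul_ofReal k hfi)
  have e1 : ∫ y : ℝ, Complex.exp (Complex.I * k * y) * ((g y : ℝ) : ℂ)
      = 2 * ((√(q : ℝ) : ℂ) * charElem p (q - 1) k - (√((p : ℝ) + 1) : ℂ) * charElem (p + 1) q k)
      := by
    unfold charElem
    rw [← integral_const_mul, ← integral_const_mul, ← integral_sub, ← integral_const_mul]
    · congr 1; ext y; simp only [hg]; push_cast; ring
    · exact (integrable_cexp_mul_ofReal k (integrable_waveFunction_mul p (q - 1))).const_mul _
    · exact (integrable_cexp_mul_ofReal k (integrable_waveFunction_mul (p + 1) q)).const_mul _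
  have e2 : ∫ y : ℝ, Complex.I * k * Complex.exp (Complex.I * k * y) * ((f y : ℝ) : ℂ)
      = Complex.I * k * charElem p q k := by
    unfold charElem
    rw [← integral_const_mul]
    congr 1; ext y; simp only [hf]; ring
  rw [e1, e2] at key
  linear_combination (-1 / 2 : ℂ) * key

lemma charElem_zero_zero (k : ℝ) : charElem 0 0 k = Complex.exp (-(k : ℂ) ^ 2 / 8) := by
  have hc : waveNorm 0 ^ 2 = √(2 / Real.pi) := by
    have : (0 : ℝ) ≤ 2 / Real.pi := by positivity
    simp only [waveNorm, pow_zero, Nat.factorial_zero, Nat.cast_one, mul_one, Real.sqrt_one,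
      div_one]
    rw [← Real.rpow_natCast, ← Real.rpow_mul this, Real.sqrt_eq_rpow]
    norm_num
  have h := integral_cexp_quadratic (b := -2) (by norm_num) (Complex.I * k) 0
  have h2 : charElem 0 0 k = ((waveNorm 0 ^ 2 : ℝ) : ℂ)
      * ∫ x : ℝ, Complex.exp (-2 * x ^ 2 + Complex.I * k * x + 0) := by
    unfold charElem
    rw [← integral_const_mul]
    congr 1; ext y
    have : Complex.exp (-2 * y ^ 2 + Complex.I * k * y + 0)
        = Complex.exp (Complex.I * k * y) * (Complex.exp (-y ^ 2) * Complex.exp (-y ^ 2)) := by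
      rw [← Complex.exp_add, ← Complex.exp_add]; congr 1; ring
    rw [this]
    simp only [waveFunction_eq, hermiteH, Polynomial.eval_one]
    push_cast
    ring
  rw [h2, h, hc]
  have h3 : ((Real.pi : ℂ) / -(-2)) ^ (1 / 2 : ℂ) = ((√(Real.pi / 2) : ℝ) : ℂ) := by
    rw [Real.sqrt_eq_rpow, Complex.ofReal_cpow (by positivity)]
    norm_num
  rw [h3, ← mul_assoc, ← Complex.ofReal_mul, ← Real.sqrt_mul (by positivity)]
  have h4 : 2 / Real.pi * (Real.pi / 2) = 1 := by field_simp
  rw [h4]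
  simp only [Real.sqrt_one, Complex.ofReal_one, one_mul]
  congr 1
  rw [mul_pow, Complex.I_sq]
  ring

/-- The polynomial `√(p! q!) e^{-β²/2} ⟨p| e^{β(a + a†)} |q⟩`. -/
def ladderSum (β : ℂ) (p q : ℕ) : ℂ :=
  ∑ t ∈ Finset.range (p + 1),
    (p.choose t : ℂ) * (q.choose t) * (t.factorial) * β ^ (p - t) * β ^ (q - t)

lemma ladderSum_zero_left (β : ℂ) (q : ℕ) : ladderSum β 0 q = β ^ q := by
  simp [ladderSum]

/-- Pascal's rule splits the binomial coefficient of p+1, and (t+1)·C(q,t+1) = q·C(q-1,t) absorbs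
the shifted part. This is the recursion of `charElem_ladder` once the square roots of factorials are
cleared. -/
lemma ladderSum_succ_left (β : ℂ) (p q : ℕ) :
    ladderSum β (p + 1) q = q * ladderSum β p (q - 1) + β * ladderSum β p q := by
  have hlast : ladderSum β p q = ∑ t ∈ Finset.range (p + 1 + 1),
      (p.choose t : ℂ) * (q.choose t) * (t.factorial) * β ^ (p - t) * β ^ (q - t) := by
    rw [Finset.sum_range_succ, ← ladderSum]; simp
  rw [hlast, Finset.mul_sum, Finset.sum_range_succ', ladderSum, Finset.sum_range_succ', ladderSum,
    Finset.mul_sum, ← add_assoc, ← Finset.sum_add_distrib]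
  congr 1
  · refine Finset.sum_congr rfl fun t ht => ?_
    have ht' : t ≤ p := by simpa [Nat.lt_succ_iff] using ht
    have h1 : ((q.choose (t + 1) : ℕ) : ℂ) * ((t : ℂ) + 1) = q * ((q - 1).choose t : ℕ) := by
      rcases q with _ | q
      · simp
      · have := Nat.add_one_mul_choose_eq q t
        rw [Nat.add_sub_cancel]
        exact_mod_cast this.symm
    have h2 : q - (t + 1) = q - 1 - t := by omega
    -- At t = p truncated subtraction breaks the power identity, but the binomial coefficient
    -- vanishes there.
    have h3 : (p.choose (t + 1) : ℂ) * β ^ (p - t)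
        = (p.choose (t + 1) : ℂ) * (β * β ^ (p - (t + 1))) := by
      rcases ht'.lt_or_eq with h | rfl
      · rw [← pow_succ', show p - (t + 1) + 1 = p - t by omega]
      · simp
    rw [Nat.choose_succ_succ, Nat.factorial_succ, h2, Nat.add_sub_add_right]
    push_cast
    linear_combination ((p.choose t : ℂ) * t.factorial * β ^ (p - t) * β ^ (q - 1 - t)) * h1
      + ((q.choose (t + 1) : ℂ) * ((t + 1) * t.factorial) * β ^ (q - 1 - t)) * h3
  · simp [pow_succ']; ring

lemma sqrt_factorial_succ (n : ℕ) :
    √((n + 1).factorial : ℝ) = √((n : ℝ) + 1) * √(n.factorial : ℝ) := by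
  rw [← Real.sqrt_mul (by positivity), Nat.factorial_succ]; push_cast; rfl

lemma sqrt_factorial_ne_zero (n : ℕ) : (√(n.factorial : ℝ) : ℂ) ≠ 0 := by
  have : 0 < √(n.factorial : ℝ) := by positivity
  exact_mod_cast this.ne'

/-- Both sides satisfy the same recursion in p. The row p = 0 follows from the symmetry in p and q,
since the lowering term drops out when the other index is 0. -/
lemma charElem_eq_ladderSum (p q : ℕ) (k : ℝ) :
    (√(p.factorial : ℝ) : ℂ) * (√(q.factorial : ℝ) : ℂ) * charElem p q k
      = Complex.exp (-(k : ℂ) ^ 2 / 8) * ladderSum (Complex.I * k / 2) p q := by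
  induction p generalizing q with
  | zero =>
    simp only [ladderSum_zero_left, Nat.factorial_zero, Nat.cast_one, Real.sqrt_one,
      Complex.ofReal_one, one_mul]
    induction q with
    | zero => simp [charElem_zero_zero]
    | succ q ih =>
      have h := charElem_ladder q 0 k
      rw [charElem_comm (q + 1), charElem_comm q 0] at h
      simp only [Nat.cast_zero, Real.sqrt_zero, Complex.ofReal_zero, zero_mul, zero_add] at h
      rw [sqrt_factorial_succ, Complex.ofReal_mul]
      linear_combination (√(q.factorial : ℝ) : ℂ) * h + (Complex.I * k / 2) * ih
  | succ p ih =>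
    have h := charElem_ladder p q k
    rw [sqrt_factorial_succ, Complex.ofReal_mul, ladderSum_succ_left]
    rcases q with _ | q
    · have := ih 0
      simp only [Nat.cast_zero, Real.sqrt_zero, Complex.ofReal_zero, zero_mul, zero_add] at h ⊢
      linear_combination (√(p.factorial : ℝ) : ℂ) * (√((0 : ℕ).factorial : ℝ) : ℂ) * h
        + (Complex.I * k / 2) * this
    · have h1 := ih q
      have h2 := ih (q + 1)
      have h3 : (√((q + 1 : ℕ) : ℝ) : ℂ) * (√((q + 1).factorial : ℝ) : ℂ)
          = ((q + 1 : ℕ) : ℂ) * (√(q.factorial : ℝ) : ℂ) := by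
        rw [sqrt_factorial_succ, Complex.ofReal_mul, ← mul_assoc, ← Complex.ofReal_mul]
        push_cast
        rw [← Complex.ofReal_mul, Real.mul_self_sqrt (by positivity)]
        push_cast; ring
      rw [Nat.add_sub_cancel] at h ⊢
      linear_combination (√(p.factorial : ℝ) : ℂ) * (√((q + 1).factorial : ℝ) : ℂ) * h
        + (Complex.I * k / 2) * h2 + ((q + 1 : ℕ) : ℂ) * h1
        + (√(p.factorial : ℝ) : ℂ) * charElem p q k * h3

lemma ladderSum_zero (p q : ℕ) : ladderSum 0 p q = if p = q then (p.factorial : ℂ) else 0 := by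
  unfold ladderSum
  split_ifs with h
  · subst h
    rw [Finset.sum_eq_single p]
    · simp
    · intro t ht htp
      have : p - t ≠ 0 := by simp at ht; omega
      simp [zero_pow this]
    · simp
  · refine Finset.sum_eq_zero fun t ht => ?_
    by_cases h1 : p - t = 0
    · by_cases h2 : q - t = 0
      · have ht' : t = p := by simp at ht; omega
        have : q.choose t = 0 := Nat.choose_eq_zero_of_lt (by omega)
        simp [this]
      · simp [zero_pow h2]
    · simp [zero_pow h1]

/-- Orthonormality is the case k = 0 of the closed form, where only t = p = q survives. -/
lemma integral_waveFunction_mul (p q : ℕ) :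
    ∫ y : ℝ, waveFunction p y * waveFunction q y = if p = q then 1 else 0 := by
  have h0 : charElem p q 0 = ((∫ y : ℝ, waveFunction p y * waveFunction q y : ℝ) : ℂ) := by
    rw [← integral_complex_ofReal]; simp [charElem]
  have h := charElem_eq_ladderSum p q 0
  simp only [Complex.ofReal_zero, mul_zero, zero_div, ladderSum_zero] at h
  rw [h0] at h
  have h1 := sqrt_factorial_ne_zero p
  have h2 := sqrt_factorial_ne_zero q
  split_ifs at h ⊢ with hpq
  · subst hpq
    have h3 : (√(p.factorial : ℝ) : ℂ) * (√(p.factorial : ℝ) : ℂ) = (p.factorial : ℂ) := by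
      rw [← Complex.ofReal_mul, Real.mul_self_sqrt (by positivity)]; simp
    rw [h3] at h
    have h4 : (p.factorial : ℂ) ≠ 0 := by exact_mod_cast p.factorial_ne_zero
    have : ((∫ y : ℝ, waveFunction p y * waveFunction p y : ℝ) : ℂ) = 1 :=
      mul_left_cancel₀ h4 (by simpa using h)
    exact_mod_cast this
  · simpa [h1, h2] using h

/-! ### Decay of the matrix elements in k, and their generating function -/

lemma norm_charElem_le_one (p q : ℕ) (k : ℝ) : ‖charElem p q k‖ ≤ 1 := by
  have h : ∀ n, ∫ y : ℝ, waveFunction n y * waveFunction n y = 1 := fun n => by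
    simp [integral_waveFunction_mul]
  have hi : Integrable fun y : ℝ => (waveFunction p y * waveFunction p y
      + waveFunction q y * waveFunction q y) * (1 / 2) :=
    ((integrable_waveFunction_mul p p).add (integrable_waveFunction_mul q q)).mul_const _
  calc ‖charElem p q k‖
      ≤ ∫ y : ℝ, (waveFunction p y * waveFunction p y
          + waveFunction q y * waveFunction q y) * (1 / 2) := by
        refine norm_integral_le_of_norm_le hi (ae_of_all _ fun y => ?_)
        rw [norm_mul, norm_cexp_I_mul_mul, one_mul, Complex.norm_real, Real.norm_eq_abs,
          abs_le]
        constructor <;>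
          nlinarith [sq_nonneg (waveFunction p y - waveFunction q y),
            sq_nonneg (waveFunction p y + waveFunction q y)]
    _ = 1 := by
        rw [integral_mul_const, integral_add (integrable_waveFunction_mul p p)
          (integrable_waveFunction_mul q q), h, h]
        norm_num

/-- Each factor |k| is traded, by `charElem_ladder`, for a shift of one index. The bound is
polynomial in p and q so that it can later be summed against r^s. -/
lemma abs_pow_mul_norm_charElem_le (j p q : ℕ) (k : ℝ) :
    |k| ^ j * ‖charElem p q k‖ ≤ (4 * ((p : ℝ) + q + j)) ^ j := by
  induction j generalizing p q with
  | zero => simpa using norm_charElem_le_one p q k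
  | succ j ih =>
    have h := charElem_ladder p q k
    have h1 : |k| * ‖charElem p q k‖
        ≤ 2 * ((p : ℝ) + 1) * ‖charElem (p + 1) q k‖ + 2 * q * ‖charElem p (q - 1) k‖ := by
      have h2 : (Complex.I * k) * charElem p q k
          = 2 * (√((p : ℝ) + 1) : ℂ) * charElem (p + 1) q k
            - 2 * (√(q : ℝ) : ℂ) * charElem p (q - 1) k := by
        linear_combination (-2 : ℂ) * h
      have h3 := congrArg norm h2
      rw [norm_mul, norm_mul, Complex.norm_I, one_mul, Complex.norm_real, Real.norm_eq_abs] at h3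
      rw [h3]
      refine (norm_sub_le _ _).trans ?_
      simp only [norm_mul, Complex.norm_real, Real.norm_eq_abs, abs_of_nonneg (Real.sqrt_nonneg _),
        Complex.norm_ofNat]
      have hp : √((p : ℝ) + 1) ≤ p + 1 := by
        rw [Real.sqrt_le_left (by positivity)]
        nlinarith [(p.cast_nonneg : (0 : ℝ) ≤ p)]
      have hq : √(q : ℝ) ≤ q := by
        rw [Real.sqrt_le_left (by positivity)]
        exact_mod_cast Nat.le_self_pow two_ne_zero q
      gcongr
    have e1 := ih (p + 1) q
    have e2 := ih p (q - 1)
    set C : ℝ := (4 * ((p : ℝ) + q + ((j + 1 : ℕ) : ℝ))) ^ j with hC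
    have e1' : |k| ^ j * ‖charElem (p + 1) q k‖ ≤ C := by
      refine e1.trans (le_of_eq ?_)
      rw [hC]; push_cast; ring
    have e2' : |k| ^ j * ‖charElem p (q - 1) k‖ ≤ C := by
      refine e2.trans ?_
      rw [hC]
      gcongr
      · exact_mod_cast Nat.sub_le q 1
      · simp
    have hC0 : 0 ≤ C := by positivity
    calc |k| ^ (j + 1) * ‖charElem p q k‖ = |k| ^ j * (|k| * ‖charElem p q k‖) := by ring
      _ ≤ |k| ^ j * (2 * ((p : ℝ) + 1) * ‖charElem (p + 1) q k‖
            + 2 * q * ‖charElem p (q - 1) k‖) := by gcongr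
      _ = 2 * ((p : ℝ) + 1) * (|k| ^ j * ‖charElem (p + 1) q k‖)
            + 2 * q * (|k| ^ j * ‖charElem p (q - 1) k‖) := by ring
      _ ≤ 2 * ((p : ℝ) + 1) * C + 2 * q * C := by gcongr
      _ ≤ (4 * ((p : ℝ) + q + ((j + 1 : ℕ) : ℝ))) * C := by
          push_cast
          nlinarith [(p.cast_nonneg : (0 : ℝ) ≤ p), (q.cast_nonneg : (0 : ℝ) ≤ q),
            (j.cast_nonneg : (0 : ℝ) ≤ j), mul_nonneg hC0 (p.cast_nonneg : (0 : ℝ) ≤ p),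
            mul_nonneg hC0 (q.cast_nonneg : (0 : ℝ) ≤ q),
            mul_nonneg hC0 (j.cast_nonneg : (0 : ℝ) ≤ j)]
      _ = (4 * ((p : ℝ) + q + ((j + 1 : ℕ) : ℝ))) ^ (j + 1) := by rw [hC, pow_succ']

lemma hasSum_sum_antidiagonal {E : Type*} [NormedAddCommGroup E] {f : ℕ × ℕ → E} {a : E}
    (h : HasSum f a) :
    HasSum (fun n => ∑ p ∈ Finset.HasAntidiagonal.antidiagonal n, f p) a := by
  have h1 := (Finset.HasAntidiagonal.sigmaAntidiagonalEquivProd (A := ℕ)).hasSum_iff.2 h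
  refine (h1.sigma fun n => ?_)
  have := hasSum_fintype (fun p : Finset.HasAntidiagonal.antidiagonal n => f p)
  convert! this using 1
  exact (Finset.sum_coe_sort _ _).symm

/-- The generating function of the matrix elements of `e^{ikX} a†²`. -/
lemma hasSum_charElem_generating (k r : ℝ) (hr0 : 0 < r) (hr1 : r < 1) :
    HasSum (fun s : ℕ => (r : ℂ) ^ s
        * ((√(((s : ℝ) + 1) * ((s : ℝ) + 2)) : ℂ) * charElem s (s + 2) k))
      (-(k : ℂ) ^ 2 / 4 / (1 - r) ^ 3
        * Complex.exp (-(k : ℂ) ^ 2 * (1 + r) / (8 * (1 - r)))) := by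
  obtain ⟨β, hβ⟩ : ∃ β : ℂ, β = Complex.I * k / 2 := ⟨_, rfl⟩
  have hβ2 : β ^ 2 = -(k : ℂ) ^ 2 / 4 := by
    rw [hβ, div_pow, mul_pow, Complex.I_sq]; ring
  have hr : ‖r‖ < 1 := by rw [Real.norm_eq_abs, abs_of_pos hr0]; exact hr1
  have hrc : ‖(r : ℂ)‖ < 1 := by rw [Complex.norm_real]; exact hr
  have hne : (1 - (r : ℂ)) ≠ 0 := by
    intro h
    have : (r : ℂ) = 1 := by linear_combination -h
    have : r = 1 := by exact_mod_cast this
    linarith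
  have hner : 0 < 1 - r := by linarith
  -- The double series in v = s - t and t. Summing over t is the negative binomial series, giving
  -- (1-r)^{-(v+3)}; the remaining sum over v is an exponential.
  set f : ℕ × ℕ → ℂ := fun p => β ^ 2 * ((β ^ 2 * r) ^ p.1 / (p.1.factorial : ℂ)
    * ((p.2 + (p.1 + 2)).choose (p.1 + 2) * (r : ℂ) ^ p.2)) with hf
  have hinner : ∀ v, HasSum (fun t => f (v, t))
      (β ^ 2 / (1 - r) ^ 3 * ((v.factorial : ℂ)⁻¹ * (β ^ 2 * r / (1 - r)) ^ v)) := fun v => by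
    have h := ((hasSum_choose_mul_geometric_of_norm_lt_one (v + 2) hrc).mul_left
      ((β ^ 2 * r) ^ v / (v.factorial : ℂ))).mul_left (β ^ 2)
    convert! h using 1
    rw [div_pow, show v + 2 + 1 = v + 3 from rfl, pow_add]
    field_simp
  have hsum : Summable f := by
    refine Summable.of_norm ?_
    rw [summable_prod_of_nonneg (fun _ => norm_nonneg _)]
    have hn : ∀ v t, ‖f (v, t)‖ = ‖β‖ ^ 2 * ((‖β‖ ^ 2 * r) ^ v / (v.factorial : ℝ)
        * ((t + (v + 2)).choose (v + 2) * r ^ t)) := fun v t => by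
      simp only [hf, norm_mul, norm_pow, norm_div, Complex.norm_natCast, Complex.norm_real,
        Real.norm_eq_abs, abs_of_pos hr0]
    have hin : ∀ v, HasSum (fun t => ‖f (v, t)‖) (‖β‖ ^ 2 / (1 - r) ^ 3
        * ((‖β‖ ^ 2 * r / (1 - r)) ^ v / (v.factorial : ℝ))) := fun v => by
      have h := ((hasSum_choose_mul_geometric_of_norm_lt_one (v + 2) hr).mul_left
        ((‖β‖ ^ 2 * r) ^ v / (v.factorial : ℝ))).mul_left (‖β‖ ^ 2)
      simp only [hn]
      convert! h using 1
      rw [div_pow, show v + 2 + 1 = v + 3 from rfl, pow_add]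
      field_simp
    refine ⟨fun v => (hin v).summable, ?_⟩
    simp only [fun v => (hin v).tsum_eq]
    exact (Real.summable_pow_div_factorial _).mul_left _
  have hout : HasSum (fun v : ℕ => β ^ 2 / (1 - r) ^ 3
      * ((v.factorial : ℂ)⁻¹ * (β ^ 2 * r / (1 - r)) ^ v))
      (β ^ 2 / (1 - r) ^ 3 * Complex.exp (β ^ 2 * r / (1 - r))) := by
    have := NormedSpace.exp_series_hasSum_exp' (𝕂 := ℂ) (β ^ 2 * r / (1 - r))
    rw [← Complex.exp_eq_exp_ℂ] at this
    simpa [smul_eq_mul] using this.mul_left (β ^ 2 / (1 - (r : ℂ)) ^ 3)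
  have htot : HasSum f (β ^ 2 / (1 - r) ^ 3 * Complex.exp (β ^ 2 * r / (1 - r))) := by
    have h := hsum.hasSum.prod_fiberwise hinner
    rw [hout.unique h]
    exact hsum.hasSum
  have hmain := (hasSum_sum_antidiagonal htot).mul_left (Complex.exp (-(k : ℂ) ^ 2 / 8))
  convert! hmain using 1
  · ext s
    have h1 := charElem_eq_ladderSum s (s + 2) k
    rw [← hβ] at h1
    have h2 : (√(((s : ℝ) + 1) * ((s : ℝ) + 2)) : ℂ) * (√(s.factorial : ℝ) : ℂ)
        = (√((s + 2).factorial : ℝ) : ℂ) := by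
      rw [sqrt_factorial_succ, sqrt_factorial_succ, ← Complex.ofReal_mul]
      congr 1
      rw [Real.sqrt_mul (by positivity)]
      push_cast
      rw [show (s : ℝ) + 1 + 1 = s + 2 by ring]
      ring
    have h3 : (√(s.factorial : ℝ) : ℂ) * (√(s.factorial : ℝ) : ℂ) = (s.factorial : ℂ) := by
      rw [← Complex.ofReal_mul, Real.mul_self_sqrt (by positivity)]; simp
    have h4 : (s.factorial : ℂ) ≠ 0 := by exact_mod_cast s.factorial_ne_zero
    have h5 : (√(((s : ℝ) + 1) * ((s : ℝ) + 2)) : ℂ) * charElem s (s + 2) k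
        = Complex.exp (-(k : ℂ) ^ 2 / 8) * (ladderSum β s (s + 2) / s.factorial) := by
      rw [← mul_div_assoc, ← h1, ← h2, eq_div_iff h4, ← h3]
      ring
    rw [h5, mul_left_comm]
    congr 1
    rw [← Finset.Nat.sum_antidiagonal_swap, Finset.Nat.sum_antidiagonal_eq_sum_range_succ_mk,
      ladderSum, Finset.sum_div, Finset.mul_sum]
    refine Finset.sum_congr rfl fun t ht => ?_
    obtain ⟨v, rfl⟩ : ∃ v, s = t + v := ⟨s - t, by simp at ht; omega⟩
    have e1 : t + v - t = v := by omega
    have e2 : t + v + 2 - t = v + 2 := by omega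
    have e3 : (((t + v + 2).choose t : ℕ) : ℂ) = ((t + (v + 2)).choose (v + 2) : ℕ) := by
      rw [← Nat.choose_symm_add]; rfl
    have e4 : (((t + v).choose t : ℕ) : ℂ) * (t.factorial : ℂ) * (v.factorial : ℂ)
        = ((t + v).factorial : ℂ) := by
      rw [Nat.choose_symm_add]
      exact_mod_cast Nat.add_choose_mul_factorial_mul_factorial t v
    have e5 : (v.factorial : ℂ) ≠ 0 := by exact_mod_cast v.factorial_ne_zero
    simp only [hf, Prod.swap, e1, e2, e3]
    rw [← e4]
    have e6 : (t.factorial : ℂ) ≠ 0 := by exact_mod_cast t.factorial_ne_zero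
    have e7 : (((t + v).choose t : ℕ) : ℂ) ≠ 0 := by
      exact_mod_cast (Nat.choose_pos (by omega)).ne'
    field_simp
    ring
  · rw [hβ2, mul_left_comm, ← Complex.exp_add]
    congr 2
    field_simp
    ring

/-! ### Ladder operators on the Fock span -/

lemma annihilation_fockKet (n : ℕ) :
    annihilation (fockKet n) = ((√(n : ℝ) : ℝ) : ℂ) • fockKet (n - 1) := by
  simp [annihilation, fockKet, Finsupp.linearCombination_single]

lemma creation_fockKet (n : ℕ) :
    creation (fockKet n) = ((√((n : ℝ) + 1) : ℝ) : ℂ) • fockKet (n + 1) := by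
  simp [creation, fockKet, Finsupp.linearCombination_single]

lemma fockSpan_hom_ext {M : Type*} [AddCommGroup M] [Module ℂ M] {f g : FockSpan →ₗ[ℂ] M}
    (h : ∀ n, f (fockKet n) = g (fockKet n)) : f = g :=
  Finsupp.lhom_ext' fun n => LinearMap.ext_ring (h n)

lemma annihilation_mul_creation : annihilation * creation = creation * annihilation + 1 := by
  refine fockSpan_hom_ext fun n => ?_
  simp only [Module.End.mul_apply, LinearMap.add_apply, Module.End.one_apply, creation_fockKet,
    annihilation_fockKet, map_smul, smul_smul, Nat.add_sub_cancel]
  rcases n with _ | n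
  · simp
  · simp only [Nat.add_sub_cancel, Nat.cast_add, Nat.cast_one, ← Complex.ofReal_mul]
    rw [Real.mul_self_sqrt (by positivity), Real.mul_self_sqrt (by positivity)]
    push_cast
    module

lemma annihilation_pow_fockKet (m s : ℕ) :
    ((√(s.factorial : ℝ) : ℝ) : ℂ) • (annihilation ^ m) (fockKet (m + s))
      = ((√((m + s).factorial : ℝ) : ℝ) : ℂ) • fockKet s := by
  induction m with
  | zero => simp
  | succ m ih =>
    rw [pow_succ, Module.End.mul_apply, annihilation_fockKet, map_smul,
      show m + 1 + s - 1 = m + s by omega, smul_comm, ih, smul_smul,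
      show m + 1 + s = (m + s) + 1 by omega, sqrt_factorial_succ]
    push_cast
    rfl

lemma annihilation_pow_fockKet_of_lt {m q : ℕ} (h : q < m) :
    (annihilation ^ m) (fockKet q) = 0 := by
  induction m generalizing q with
  | zero => omega
  | succ m ih =>
    rw [pow_succ, Module.End.mul_apply, annihilation_fockKet, map_smul]
    rcases q with _ | q
    · simp
    · rw [Nat.add_sub_cancel, ih (by omega), smul_zero]

lemma creation_pow_fockKet (n s : ℕ) :
    ((√(s.factorial : ℝ) : ℝ) : ℂ) • (creation ^ n) (fockKet s)
      = ((√((n + s).factorial : ℝ) : ℝ) : ℂ) • fockKet (n + s) := by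
  induction n with
  | zero => simp
  | succ n ih =>
    rw [pow_succ', Module.End.mul_apply, ← map_smul, ih, map_smul, creation_fockKet, smul_smul,
      show n + 1 + s = (n + s) + 1 by omega, sqrt_factorial_succ, ← Complex.ofReal_mul, mul_comm]
lemma fockMatrix_moment_add (n m s p : ℕ) :
    fockMatrix (creation ^ n * annihilation ^ m) p (m + s)
      = if p = n + s then
          ((√((n + s).factorial : ℝ) * √((m + s).factorial : ℝ) / s.factorial : ℝ) : ℂ) else 0 := by
  have h0 := sqrt_factorial_ne_zero s
  have h1 : (annihilation ^ m) (fockKet (m + s))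
      = (((√(s.factorial : ℝ) : ℝ) : ℂ)⁻¹ * ((√((m + s).factorial : ℝ) : ℝ) : ℂ)) • fockKet s := by
    rw [mul_smul, ← annihilation_pow_fockKet, inv_smul_smul₀ h0]
  have h2 : (creation ^ n) (fockKet s)
      = (((√(s.factorial : ℝ) : ℝ) : ℂ)⁻¹ * ((√((n + s).factorial : ℝ) : ℝ) : ℂ))
        • fockKet (n + s) := by
    rw [mul_smul, ← creation_pow_fockKet, inv_smul_smul₀ h0]
  have h3 : ((√(s.factorial : ℝ) : ℝ) : ℂ)⁻¹ * ((√(s.factorial : ℝ) : ℝ) : ℂ)⁻¹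
      = (s.factorial : ℂ)⁻¹ := by
    rw [← mul_inv, ← Complex.ofReal_mul, Real.mul_self_sqrt (by positivity)]; simp
  rw [fockMatrix, Matrix.of_apply, Module.End.mul_apply, h1, map_smul, h2, smul_smul]
  simp only [fockKet, Finsupp.smul_apply, Finsupp.single_apply, smul_eq_mul, eq_comm (a := n + s)]
  split_ifs
  · push_cast
    rw [div_eq_mul_inv, ← h3]
    ring
  · simp

lemma fockMatrix_moment_of_lt {n m p q : ℕ} (h : q < m) :
    fockMatrix (creation ^ n * annihilation ^ m) p q = 0 := by
  rw [fockMatrix, Matrix.of_apply, Module.End.mul_apply, annihilation_pow_fockKet_of_lt h]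
  simp

/-! ### Polynomials in the quadrature -/

/-- The pairing with the generalized eigenvector, `v ↦ φ⟨x|v⟩`. -/
def quadBra (x φ : ℝ) : FockSpan →ₗ[ℂ] ℂ :=
  Finsupp.linearCombination ℂ fun n => (starRingEnd ℂ) (quadKet x φ n)

lemma quadBra_fockKet (x φ : ℝ) (n : ℕ) :
    quadBra x φ (fockKet n) = (starRingEnd ℂ) (quadKet x φ n) := by
  simp [quadBra, fockKet, Finsupp.linearCombination_single]

lemma conj_quadKet (x φ : ℝ) (n : ℕ) :
    (starRingEnd ℂ) (quadKet x φ n)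
      = Complex.exp (-(Complex.I * φ * n)) * (waveFunction n x : ℂ) := by
  rw [quadKet, map_mul, Complex.conj_ofReal, ← Complex.exp_conj]
  simp

lemma quadProj_apply (x φ : ℝ) (p q : ℕ) :
    quadProj x φ p q = Complex.exp (Complex.I * φ * ((p : ℂ) - q))
      * ((waveFunction p x * waveFunction q x : ℝ) : ℂ) := by
  rw [quadProj, Matrix.of_apply, conj_quadKet, quadKet]
  have : Complex.exp (Complex.I * φ * ((p : ℂ) - q))
      = Complex.exp (Complex.I * φ * p) * Complex.exp (-(Complex.I * φ * q)) := by
    rw [← Complex.exp_add]; congr 1; ring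
  rw [this]
  push_cast
  ring

/-- The three-term recurrence of the wave functions in disguise: the phases of a† and a compensate
the index shift in e^{-iφn}. Under this pairing polynomials in X_φ become scalars. -/
lemma quadBra_quadrature (x φ : ℝ) (v : FockSpan) :
    quadBra x φ (quadrature φ v) = x * quadBra x φ v := by
  have h : (quadBra x φ).comp (quadrature φ) = (x : ℂ) • quadBra x φ := by
    refine fockSpan_hom_ext fun n => ?_
    have hw : (2 * x * waveFunction n x : ℂ) = (√((n : ℝ) + 1) : ℂ) * waveFunction (n + 1) x
        + (√(n : ℝ) : ℂ) * waveFunction (n - 1) x := by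
      exact_mod_cast two_mul_self_mul_waveFunction n x
    have e1 : Complex.exp (Complex.I * φ) * Complex.exp (-(Complex.I * φ * ((n + 1 : ℕ) : ℂ)))
        = Complex.exp (-(Complex.I * φ * n)) := by
      rw [← Complex.exp_add]; congr 1; push_cast; ring
    -- The factor √n is kept because at n = 0 the truncated index n - 1 makes the phase identity
    -- itself fail.
    have e2 : (√(n : ℝ) : ℂ) * (Complex.exp (-(Complex.I * φ))
          * Complex.exp (-(Complex.I * φ * ((n - 1 : ℕ) : ℂ))))
        = (√(n : ℝ) : ℂ) * Complex.exp (-(Complex.I * φ * n)) := by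
      rcases n with _ | n
      · simp
      · rw [← Complex.exp_add]; congr 2; push_cast [Nat.add_sub_cancel]; ring
    simp only [LinearMap.comp_apply, LinearMap.smul_apply, quadrature, LinearMap.add_apply,
      map_smul, map_add, creation_fockKet, annihilation_fockKet, quadBra_fockKet, conj_quadKet,
      smul_eq_mul]
    linear_combination (1 / 2 : ℂ) * (√((n : ℝ) + 1) : ℂ) * waveFunction (n + 1) x * e1
      + (1 / 2 : ℂ) * waveFunction (n - 1) x * e2
      - (1 / 2 : ℂ) * Complex.exp (-(Complex.I * φ * n)) * hw
  simpa using LinearMap.congr_fun h v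

lemma quadBra_aeval (x φ : ℝ) (P : Polynomial ℝ) (v : FockSpan) :
    quadBra x φ (Polynomial.aeval (((√2 : ℝ) : ℂ) • quadrature φ) P v)
      = (P.eval (√2 * x) : ℝ) * quadBra x φ v := by
  have h1 : ∀ w, quadBra x φ ((((√2 : ℝ) : ℂ) • quadrature φ) w)
      = ((√2 * x : ℝ) : ℂ) * quadBra x φ w := fun w => by
    rw [LinearMap.smul_apply, map_smul, quadBra_quadrature]
    push_cast
    simp [mul_assoc]
  induction P using Polynomial.induction_on' with
  | add p q hp hq => simp [hp, hq, add_mul]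
  | monomial n a =>
    rw [Polynomial.aeval_monomial, Polynomial.eval_monomial, ← Algebra.smul_def,
      LinearMap.smul_apply, LinearMap.map_smul_of_tower]
    have h2 : ∀ n, quadBra x φ (((((√2 : ℝ) : ℂ) • quadrature φ) ^ n) v)
        = (((√2 * x) ^ n : ℝ) : ℂ) * quadBra x φ v := fun n => by
      induction n with
      | zero => simp
      | succ n ih =>
        rw [pow_succ', Module.End.mul_apply, h1, ih]
        push_cast
        ring
    rw [h2]
    push_cast
    rw [Complex.real_smul]
    ring

lemma integrable_polynomial_mul_quadProj (P : Polynomial ℝ) (φ : ℝ) (p q : ℕ) :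
    Integrable fun x : ℝ => ((P.eval x : ℝ) : ℂ) * quadProj x φ p q := by
  have h := ((integrable_polynomial_mul_waveFunction_mul P p q).ofReal (𝕜 := ℂ)).const_mul
    (Complex.exp (Complex.I * φ * ((p : ℂ) - q)))
  refine h.congr (ae_of_all _ fun x => ?_)
  simp only [quadProj_apply, RCLike.ofReal_mul, Complex.ofReal_mul]
  simp only [Complex.coe_algebraMap]
  ring

lemma integral_quadProj (φ : ℝ) (p q : ℕ) :
    ∫ x : ℝ, quadProj x φ p q = if p = q then 1 else 0 := by
  simp only [quadProj_apply]
  rw [integral_const_mul, integral_complex_ofReal, integral_waveFunction_mul]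
  split_ifs with h
  · simp [h]
  · simp

/-- The resolution of the identity by the |x⟩_φ, which on finite combinations is just
orthonormality. -/
lemma integral_quadKet_mul_quadBra (φ : ℝ) (p : ℕ) (v : FockSpan) :
    ∫ x : ℝ, quadKet x φ p * quadBra x φ v = v p := by
  have : (fun x : ℝ => quadKet x φ p * quadBra x φ v)
      = fun x => ∑ q ∈ v.support, v q * quadProj x φ p q := by
    ext x
    rw [quadBra, Finsupp.linearCombination_apply, Finsupp.sum, Finset.mul_sum]
    refine Finset.sum_congr rfl fun q _ => ?_
    rw [quadProj, Matrix.of_apply, smul_eq_mul]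
    ring
  rw [this, integral_finsetSum]
  · simp only [integral_const_mul, integral_quadProj]
    simp +contextual
  · intro q _
    refine Integrable.const_mul ?_ _
    simpa using integrable_polynomial_mul_quadProj 1 φ p q

lemma integral_polynomial_mul_quadProj (P : Polynomial ℝ) (φ : ℝ) (p q : ℕ) :
    ∫ x : ℝ, ((P.eval (√2 * x) : ℝ) : ℂ) * quadProj x φ p q
      = fockMatrix (Polynomial.aeval (((√2 : ℝ) : ℂ) • quadrature φ) P) p q := by
  rw [fockMatrix, Matrix.of_apply, ← integral_quadKet_mul_quadBra φ p]
  congr 1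
  ext x
  rw [quadBra_aeval, quadBra_fockKet, quadProj, Matrix.of_apply]
  ring

/-! ### Normal ordering -/

/-- The normally ordered power `:(c + d)^n:`, all factors `c` standing to the left. -/
def normalPow {R : Type*} [Ring R] (c d : R) : ℕ → R
  | 0 => 1
  | n + 1 => c * normalPow c d n + normalPow c d n * d

/-- Left multiplication by c commutes with right multiplication by d even when c and d do not
commute, so the ordinary binomial theorem applies to their sum acting on 1. -/
lemma normalPow_eq_sum {R : Type*} [Ring R] (c d : R) (n : ℕ) :
    normalPow c d n = ∑ k ∈ Finset.range (n + 1), (n.choose k) • (c ^ k * d ^ (n - k)) := by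
  have h1 : ∀ n, normalPow c d n
      = ((LinearMap.mulLeft ℤ c + LinearMap.mulRight ℤ d) ^ n) 1 := fun n => by
    induction n with
    | zero => simp [normalPow]
    | succ n ih =>
      rw [pow_succ', Module.End.mul_apply, ← ih]
      simp [normalPow]
  rw [h1, (LinearMap.commute_mulLeft_right (R := ℤ) c d).add_pow]
  simp only [LinearMap.sum_apply, ← nsmul_eq_mul', LinearMap.smul_apply]
  refine Finset.sum_congr rfl fun k _ => ?_
  rw [Module.End.mul_apply, LinearMap.pow_mulLeft, LinearMap.pow_mulRight]
  simp

/-- Commutation with d acts as differentiation in c, hence lowers the normally ordered power like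
d/dy of y^{n+1}. -/
lemma mul_normalPow_succ {R : Type*} [Ring R] {c d : R} (h : d * c = c * d + 1) (n : ℕ) :
    d * normalPow c d (n + 1)
      = normalPow c d (n + 1) * d + ((n : R) + 1) * normalPow c d n := by
  induction n with
  | zero => simp [normalPow, mul_add, add_mul, h]; abel
  | succ n ih =>
    have h1 : normalPow c d (n + 1 + 1)
        = c * normalPow c d (n + 1) + normalPow c d (n + 1) * d := rfl
    have h2 : normalPow c d (n + 1) = c * normalPow c d n + normalPow c d n * d := rfl
    have h3 : ((n : R) + 1) * c = c * ((n : R) + 1) := by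
      rw [add_mul, mul_add, (Nat.cast_commute n c).eq]; simp
    calc d * normalPow c d (n + 1 + 1)
        = (d * c) * normalPow c d (n + 1) + (d * normalPow c d (n + 1)) * d := by
          rw [h1, mul_add, mul_assoc, mul_assoc]
      _ = c * (d * normalPow c d (n + 1)) + normalPow c d (n + 1)
            + (d * normalPow c d (n + 1)) * d := by
          rw [h]; noncomm_ring
      _ = normalPow c d (n + 1 + 1) * d + (((n + 1 : ℕ) : R) + 1) * normalPow c d (n + 1) := by
          rw [ih, h1]
          have h4 : c * (((n : R) + 1) * normalPow c d n) + ((n : R) + 1) * normalPow c d n * d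
              = ((n : R) + 1) * normalPow c d (n + 1) := by
            rw [h2, ← mul_assoc, ← h3]; noncomm_ring
          have h5 : (((n + 1 : ℕ) : R) + 1) * normalPow c d (n + 1)
              = ((n : R) + 1) * normalPow c d (n + 1) + normalPow c d (n + 1) := by
            push_cast; noncomm_ring
          rw [h5, ← h4]
          noncomm_ring

lemma normalPow_succ_succ {R : Type*} [Ring R] {c d : R} (h : d * c = c * d + 1) (n : ℕ) :
    normalPow c d (n + 2)
      = (c + d) * normalPow c d (n + 1) - ((n : R) + 1) * normalPow c d n := by
  rw [add_mul, mul_normalPow_succ h, normalPow]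
  abel

lemma aeval_hermiteH_quadrature (φ : ℝ) (n : ℕ) :
    Polynomial.aeval (((√2 : ℝ) : ℂ) • quadrature φ) (hermiteH n)
      = (((√2 : ℝ) ^ n : ℝ) : ℂ) • normalPow (Complex.exp (Complex.I * φ) • creation)
          (Complex.exp (-(Complex.I * φ)) • annihilation) n := by
  set c : Module.End ℂ FockSpan := Complex.exp (Complex.I * φ) • creation with hc
  set d : Module.End ℂ FockSpan := Complex.exp (-(Complex.I * φ)) • annihilation with hd
  have hcd : d * c = c * d + 1 := by
    have e1 : Complex.exp (-(Complex.I * φ)) * Complex.exp (Complex.I * φ) = 1 := by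
      rw [← Complex.exp_add]; simp
    rw [hc, hd, smul_mul_smul_comm, smul_mul_smul_comm, annihilation_mul_creation,
      mul_comm (Complex.exp (Complex.I * φ)), e1, one_smul, one_smul]
  have hq : ((√2 : ℝ) : ℂ) • quadrature φ = (((√2 : ℝ) : ℂ) / 2) • (c + d) := by
    rw [quadrature, smul_smul, ← hc, ← hd]
    congr 1
    ring
  have hs : ((√2 : ℝ) : ℂ) * ((√2 : ℝ) : ℂ) = 2 := by
    rw [← Complex.ofReal_mul, Real.mul_self_sqrt (by norm_num)]; simp
  -- The recurrence has order two, so the induction carries two consecutive degrees.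
  have h01 : ∀ n, Polynomial.aeval (((√2 : ℝ) : ℂ) • quadrature φ) (hermiteH n)
        = (((√2 : ℝ) ^ n : ℝ) : ℂ) • normalPow c d n ∧
      Polynomial.aeval (((√2 : ℝ) : ℂ) • quadrature φ) (hermiteH (n + 1))
        = (((√2 : ℝ) ^ (n + 1) : ℝ) : ℂ) • normalPow c d (n + 1) := fun n => by
    induction n with
    | zero =>
      refine ⟨by simp [hermiteH, normalPow], ?_⟩
      have e : hermiteH (0 + 1) = 2 * Polynomial.X := by simp [hermiteH]
      rw [e, map_mul, Polynomial.aeval_X, hq, map_ofNat]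
      have e2 : (2 : Module.End ℂ FockSpan) = (2 : ℂ) • 1 := by
        rw [Algebra.smul_def, mul_one, map_ofNat]
      rw [e2, smul_mul_smul_comm, one_mul]
      simp only [normalPow, mul_one, one_mul, zero_add, pow_one]
      congr 1
      ring
    | succ n ih =>
      refine ⟨ih.2, ?_⟩
      have e1 : (2 : Module.End ℂ FockSpan) = (2 : ℂ) • 1 := by
        rw [Algebra.smul_def, mul_one, map_ofNat]
      have e2 : (n : Module.End ℂ FockSpan) + 1 = ((n : ℂ) + 1) • 1 := by
        rw [Algebra.smul_def, mul_one]; simp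
      rw [hermiteH_succ_succ]
      simp only [map_sub, map_mul, map_add, map_ofNat, map_natCast, map_one, Polynomial.aeval_X,
        ih.1, ih.2]
      rw [normalPow_succ_succ hcd, hq, e1, e2]
      simp only [smul_mul_smul_comm, one_mul, smul_sub]
      congr 1
      · congr 1
        push_cast
        ring
      · rw [smul_mul_assoc, one_mul, smul_smul]
        congr 1
        push_cast
        linear_combination (-((√2 : ℝ) : ℂ) ^ n * ((n : ℂ) + 1)) * hs
  exact (h01 n).1

/-- The phases combine as (m-n) + k - (n+m-k) = 2(k-n). Only even harmonics occur, which is why the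
half period [0,π] suffices to isolate k = n. -/
lemma fockMatrix_richterOperator (n m : ℕ) (φ : ℝ) (p q : ℕ) :
    fockMatrix (richterOperator n m φ) p q
      = (((n + m).choose n : ℕ) : ℂ)⁻¹ * ∑ k ∈ Finset.range (n + m + 1),
          (((n + m).choose k : ℕ) : ℂ) * Complex.exp (2 * Complex.I * ((k : ℂ) - n) * φ)
            * fockMatrix (creation ^ k * annihilation ^ (n + m - k)) p q := by
  have hs : √((2 : ℝ) ^ (n + m)) = √2 ^ (n + m) := by
    have : ((√2 : ℝ) ^ (n + m)) ^ 2 = 2 ^ (n + m) := by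
      rw [← pow_mul, mul_comm, pow_mul, Real.sq_sqrt (by norm_num)]
    rw [← this, Real.sqrt_sq (by positivity)]
  have hs0 : (√2 : ℝ) ^ (n + m) ≠ 0 := by positivity
  rw [richterOperator, aeval_hermiteH_quadrature, smul_smul, hs, normalPow_eq_sum]
  have e0 : ((((((n + m).choose n : ℕ) : ℝ)⁻¹ * (√2 ^ (n + m))⁻¹ : ℝ) : ℂ)
      * Complex.exp (Complex.I * φ * ((m : ℂ) - n))) * ((√2 ^ (n + m) : ℝ) : ℂ)
      = (((n + m).choose n : ℕ) : ℂ)⁻¹ * Complex.exp (Complex.I * φ * ((m : ℂ) - n)) := by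
    rw [Complex.ofReal_mul, Complex.ofReal_inv (√2 ^ (n + m))]
    have : ((√2 ^ (n + m) : ℝ) : ℂ) ≠ 0 := by exact_mod_cast hs0
    field_simp
    push_cast
    field_simp
  rw [e0, mul_smul, Finset.smul_sum]
  simp only [fockMatrix, Matrix.of_apply, LinearMap.smul_apply, LinearMap.sum_apply,
    Finsupp.smul_apply, Finsupp.finsetSum_apply, smul_eq_mul]
  congr 1
  refine Finset.sum_congr rfl fun k hk => ?_
  have hk' : k ≤ n + m := by simp at hk; omega
  have e1 : Complex.exp (2 * Complex.I * ((k : ℂ) - n) * φ)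
      = Complex.exp (Complex.I * φ * ((m : ℂ) - n)) * (Complex.exp (Complex.I * φ) ^ k
        * Complex.exp (-(Complex.I * φ)) ^ (n + m - k)) := by
    rw [← Complex.exp_nat_mul, ← Complex.exp_nat_mul, ← Complex.exp_add, ← Complex.exp_add]
    congr 1
    push_cast [Nat.cast_sub hk']
    ring
  rw [e1, smul_pow, smul_pow, smul_mul_smul_comm]
  simp only [LinearMap.smul_apply, Finsupp.smul_apply, smul_eq_mul, nsmul_eq_mul]
  ring

lemma integral_cexp_two_mul_I (j : ℤ) :
    ∫ φ in (0 : ℝ)..Real.pi, Complex.exp (2 * Complex.I * (j : ℂ) * φ)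
      = if j = 0 then (Real.pi : ℂ) else 0 := by
  split_ifs with h
  · simp [h]
  · have hne : 2 * Complex.I * (j : ℂ) ≠ 0 := by simp [h]
    rw [integral_exp_mul_complex hne]
    have : 2 * Complex.I * (j : ℂ) * (Real.pi : ℂ) = j * (2 * Real.pi * Complex.I) := by ring
    rw [this, Complex.exp_int_mul_two_pi_mul_I]
    simp

lemma continuous_fockMatrix_richterOperator (n m p q : ℕ) :
    Continuous fun φ : ℝ => fockMatrix (richterOperator n m φ) p q := by
  simp only [fockMatrix_richterOperator]
  fun_prop

/-- Richter's expansion of the normally ordered moments. -/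
lemma integral_fockMatrix_richterOperator (n m p q : ℕ) :
    (1 / (Real.pi : ℂ)) * ∫ φ in (0 : ℝ)..Real.pi, fockMatrix (richterOperator n m φ) p q
      = fockMatrix (creation ^ n * annihilation ^ m) p q := by
  have hpi : (Real.pi : ℂ) ≠ 0 := by exact_mod_cast Real.pi_ne_zero
  have hch : (((n + m).choose n : ℕ) : ℂ) ≠ 0 := by
    exact_mod_cast (Nat.choose_pos (Nat.le_add_right n m)).ne'
  simp only [fockMatrix_richterOperator]
  rw [intervalIntegral.integral_const_mul, intervalIntegral.integral_finsetSum]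
  · have h : ∀ k : ℕ, ∫ φ in (0 : ℝ)..Real.pi, Complex.exp (2 * Complex.I * ((k : ℂ) - n) * φ)
        = if k = n then (Real.pi : ℂ) else 0 := fun k => by
      have := integral_cexp_two_mul_I ((k : ℤ) - n)
      push_cast at this
      rw [this]
      simp [sub_eq_zero]
    simp only [intervalIntegral.integral_mul_const, intervalIntegral.integral_const_mul, h]
    rw [Finset.sum_eq_single n]
    · simp only [if_true, Nat.add_sub_cancel_left]
      field_simp
    · intro k _ hk
      simp [hk]
    · simp
  · intro k _
    exact (by fun_prop : Continuous _).intervalIntegrable _ _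

lemma momentEstimator_eq (n m : ℕ) (x φ : ℝ) :
    momentEstimator n m x φ = (((((n + m).choose n : ℕ) : ℝ)⁻¹ * (√((2 : ℝ) ^ (n + m)))⁻¹ : ℝ) : ℂ)
      * Complex.exp (Complex.I * φ * ((m : ℂ) - n))
      * (((hermiteH (n + m)).eval (√2 * x) : ℝ) : ℂ) := by
  rw [momentEstimator, momentCoeff]
  push_cast
  ring

lemma integrable_momentEstimator_mul_quadProj (n m p q : ℕ) (φ : ℝ) :
    Integrable fun x : ℝ => momentEstimator n m x φ * quadProj x φ p q := by
  have h := (integrable_polynomial_mul_quadProj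
    ((hermiteH (n + m)).comp (Polynomial.C √2 * Polynomial.X)) φ p q).const_mul
    ((((((n + m).choose n : ℕ) : ℝ)⁻¹ * (√((2 : ℝ) ^ (n + m)))⁻¹ : ℝ) : ℂ)
      * Complex.exp (Complex.I * φ * ((m : ℂ) - n)))
  refine h.congr (ae_of_all _ fun x => ?_)
  simp only [momentEstimator_eq, Polynomial.eval_comp, Polynomial.eval_mul, Polynomial.eval_C,
    Polynomial.eval_X]
  ring

lemma quadFunction_momentEstimator (n m p q : ℕ) (φ : ℝ) :
    quadFunction φ (fun x => momentEstimator n m x φ) p q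
      = fockMatrix (richterOperator n m φ) p q := by
  rw [quadFunction, Matrix.of_apply]
  simp only [momentEstimator_eq, mul_assoc]
  rw [integral_const_mul, integral_const_mul, integral_polynomial_mul_quadProj, richterOperator]
  simp only [fockMatrix, Matrix.of_apply, LinearMap.smul_apply, Finsupp.smul_apply, smul_eq_mul,
    mul_assoc]

/-! ### Growth of the moment coefficients -/

/-- For large n the recurrence is nearly f(n+2) ≤ f(n). A bound Kρⁿ propagates as soon as ερ + 1 ≤
ρ², and K is taken large enough to cover the finitely many earlier values. -/
lemma exists_geometric_bound_of_recurrence {f ε : ℕ → ℝ} (hf : ∀ n, 0 ≤ f n)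
    (hε : Tendsto ε atTop (𝓝 0)) (h : ∀ n, f (n + 2) ≤ ε n * f (n + 1) + f n)
    {ρ : ℝ} (hρ : 1 < ρ) : ∃ K, 0 ≤ K ∧ ∀ n, f n ≤ K * ρ ^ n := by
  have hρ0 : 0 < ρ := by linarith
  have hpos : 0 < (ρ ^ 2 - 1) / ρ := div_pos (by nlinarith) hρ0
  obtain ⟨n₀, hn₀⟩ := eventually_atTop.1 (hε.eventually_le_const hpos)
  set K := ∑ k ∈ Finset.range (n₀ + 2), f k with hK
  have hK0 : 0 ≤ K := Finset.sum_nonneg fun k _ => hf k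
  refine ⟨K, hK0, fun n => ?_⟩
  induction n using Nat.strong_induction_on with
  | _ n ih =>
    by_cases hn : n < n₀ + 2
    · calc f n ≤ K := Finset.single_le_sum (fun k _ => hf k) (Finset.mem_range.2 hn)
        _ ≤ K * ρ ^ n := le_mul_of_one_le_right hK0 (one_le_pow₀ hρ.le)
    · obtain ⟨m, rfl⟩ : ∃ m, n = m + 2 := ⟨n - 2, by omega⟩
      have e1 := ih (m + 1) (by omega)
      have e2 := ih m (by omega)
      have e3 : ε m * ρ ≤ ρ ^ 2 - 1 := by
        have := hn₀ m (by omega)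
        rwa [le_div_iff₀ hρ0] at this
      calc f (m + 2) ≤ ε m * f (m + 1) + f m := h m
        _ ≤ (ρ ^ 2 - 1) / ρ * f (m + 1) + f m := by
            have := hf (m + 1)
            gcongr
            exact hn₀ m (by omega)
        _ ≤ (ρ ^ 2 - 1) / ρ * (K * ρ ^ (m + 1)) + K * ρ ^ m := by gcongr
        _ = K * ρ ^ (m + 2) := by
            field_simp
            ring

lemma exists_abs_waveFunction_le (x : ℝ) {ρ : ℝ} (hρ : 1 < ρ) :
    ∃ K, 0 ≤ K ∧ ∀ n, |waveFunction n x| ≤ K * ρ ^ n := by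
  refine exists_geometric_bound_of_recurrence (ε := fun n : ℕ => 2 * |x| / √((n : ℝ) + 2))
    (fun n => abs_nonneg _) ?_ (fun n => ?_) hρ
  · refine Tendsto.const_div_atTop (Real.tendsto_sqrt_atTop.comp ?_) _
    exact tendsto_atTop_add_const_right _ _ tendsto_natCast_atTop_atTop
  · have h := two_mul_self_mul_waveFunction (n + 1) x
    have hs : 0 < √((n : ℝ) + 2) := by positivity
    have hle : √((n : ℝ) + 1) ≤ √((n : ℝ) + 2) := Real.sqrt_le_sqrt (by linarith)
    rw [Nat.add_sub_cancel] at h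
    push_cast at h
    rw [show (n : ℝ) + 1 + 1 = n + 2 by ring] at h
    have h2 : √((n : ℝ) + 2) * |waveFunction (n + 2) x|
        ≤ 2 * |x| * |waveFunction (n + 1) x| + √((n : ℝ) + 2) * |waveFunction n x| := by
      have h3 : √((n : ℝ) + 2) * waveFunction (n + 2) x
          = 2 * x * waveFunction (n + 1) x - √((n : ℝ) + 1) * waveFunction n x := by
        rw [h]; ring
      have h4 := congrArg abs h3
      rw [abs_mul, abs_of_pos hs] at h4
      rw [h4]
      refine (abs_sub _ _).trans ?_
      rw [abs_mul, abs_mul, abs_mul, abs_two, abs_of_nonneg (Real.sqrt_nonneg _)]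
      gcongr
    rw [div_mul_eq_mul_div, ← sub_le_iff_le_add, le_div_iff₀ hs]
    linarith

/-- The size of `c_{i+t,j+t} / t!` relative to a normalized wave function. -/
def momentWeight (i j t : ℕ) : ℝ :=
  ((i + t).factorial : ℝ) * ((j + t).factorial : ℝ)
    / ((t.factorial : ℝ) * √((i + j + 2 * t).factorial : ℝ))

lemma momentWeight_pos (i j t : ℕ) : 0 < momentWeight i j t := by
  unfold momentWeight; positivity

/-- Consecutive weights have ratio tending to 1/2. The room between 1 and 2 is needed: the Abel
argument evaluates such series at 1 + r. -/
lemma summable_momentWeight_mul_pow (i j : ℕ) {z : ℝ} (hz0 : 0 < z) (hz2 : z < 2) :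
    Summable fun t => momentWeight i j t * z ^ t := by
  refine summable_of_ratio_test_tendsto_lt_one (l := z / 2) (by linarith)
    (Eventually.of_forall fun t => (mul_pos (momentWeight_pos i j t) (pow_pos hz0 t)).ne') ?_
  have h1 := tendsto_add_mul_div_add_mul_atTop_nhds ((i : ℝ) + 1) 1 1 (one_ne_zero (α := ℝ))
  have h2 := tendsto_add_mul_div_add_mul_atTop_nhds ((j : ℝ) + 1) ((i : ℝ) + j + 1) 1
    (two_ne_zero (α := ℝ))
  have h3 := tendsto_add_mul_div_add_mul_atTop_nhds ((j : ℝ) + 1) ((i : ℝ) + j + 2) 1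
    (two_ne_zero (α := ℝ))
  have h4 := ((h1.mul ((h2.mul h3).sqrt)).const_mul z)
  have e : z * (1 / 1 * √(1 / 2 * (1 / 2))) = z / 2 := by
    rw [Real.sqrt_mul_self (by norm_num)]; ring
  rw [e] at h4
  refine h4.congr fun t => ?_
  rw [Real.norm_of_nonneg (mul_pos (momentWeight_pos i j _) (pow_pos hz0 _)).le,
    Real.norm_of_nonneg (mul_pos (momentWeight_pos i j _) (pow_pos hz0 _)).le]
  have f1 : ((i + (t + 1)).factorial : ℝ) = ((i : ℝ) + 1 + 1 * t) * ((i + t).factorial : ℝ) := by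
    rw [← add_assoc, Nat.factorial_succ]; push_cast; ring
  have f2 : ((j + (t + 1)).factorial : ℝ) = ((j : ℝ) + 1 + 1 * t) * ((j + t).factorial : ℝ) := by
    rw [← add_assoc, Nat.factorial_succ]; push_cast; ring
  have f3 : ((t + 1).factorial : ℝ) = (1 + 1 * (t : ℝ)) * (t.factorial : ℝ) := by
    rw [Nat.factorial_succ]; push_cast; ring
  have f4 : √((i + j + 2 * (t + 1)).factorial : ℝ)
      = √((i : ℝ) + j + 1 + 2 * t) * √((i : ℝ) + j + 2 + 2 * t)
        * √((i + j + 2 * t).factorial : ℝ) := by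
    rw [← Real.sqrt_mul (by positivity), ← Real.sqrt_mul (by positivity)]
    congr 1
    rw [show i + j + 2 * (t + 1) = i + j + 2 * t + 1 + 1 by ring, Nat.factorial_succ,
      Nat.factorial_succ]
    push_cast
    ring
  have g0 : (0 : ℝ) < (j : ℝ) + 1 + 1 * t := by positivity
  have f5 : √(((j : ℝ) + 1 + 1 * t) / ((i : ℝ) + j + 1 + 2 * t)
      * (((j : ℝ) + 1 + 1 * t) / ((i : ℝ) + j + 2 + 2 * t)))
      = ((j : ℝ) + 1 + 1 * t) / (√((i : ℝ) + j + 1 + 2 * t) * √((i : ℝ) + j + 2 + 2 * t)) := by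
    rw [div_mul_div_comm, Real.sqrt_div (by positivity), Real.sqrt_mul_self g0.le,
      Real.sqrt_mul (by positivity)]
  rw [f5, momentWeight, momentWeight, f1, f2, f3, f4, pow_succ]
  have g1 : 0 < √((i : ℝ) + j + 1 + 2 * t) := by positivity
  have g2 : 0 < √((i : ℝ) + j + 2 + 2 * t) := by positivity
  have g3 : 0 < √((i + j + 2 * t).factorial : ℝ) := by positivity
  have g4 : (0 : ℝ) < (t.factorial : ℝ) := by positivity
  have g5 : (0 : ℝ) < ((i + t).factorial : ℝ) := by positivity
  have g6 : (0 : ℝ) < ((j + t).factorial : ℝ) := by positivity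
  have g7 : (0 : ℝ) < 1 + 1 * (t : ℝ) := by positivity
  have g8 : (0 : ℝ) < z ^ t := by positivity
  field_simp

lemma waveNorm_pos (n : ℕ) : 0 < waveNorm n := by
  unfold waveNorm
  have := Real.pi_pos
  positivity

/-- Separates the combinatorial decay from the dependence on x: the normalization hidden in
2^{-N/2}H_N is that of ψ_N up to √(N!), the Gaussian and a constant. -/
lemma momentCoeff_div_factorial (i j t : ℕ) (x : ℝ) :
    momentCoeff (i + t) (j + t) x / t.factorial
      = momentWeight i j t * ((waveNorm 0)⁻¹ * Real.exp (x ^ 2) * waveFunction (i + j + 2 * t) x)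
      := by
  have hw : waveNorm (i + j + 2 * t)
      = waveNorm 0 / (√((2 : ℝ) ^ (i + j + 2 * t)) * √((i + j + 2 * t).factorial : ℝ)) := by
    simp [waveNorm]
  have hN : i + t + (j + t) = i + j + 2 * t := by ring
  have h0 := waveNorm_pos 0
  have hch : (((i + t + (j + t)).choose (i + t) : ℕ) : ℝ)⁻¹
      = (i + t).factorial * (j + t).factorial
        / (√((i + j + 2 * t).factorial : ℝ) * √((i + j + 2 * t).factorial : ℝ)) := by
    have h1 : (((i + t + (j + t)).choose (i + t) : ℕ) : ℝ) * (i + t).factorial * (j + t).factorial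
        = (i + j + 2 * t).factorial := by
      rw [← hN, Nat.choose_symm_add]
      exact_mod_cast Nat.add_choose_mul_factorial_mul_factorial (i + t) (j + t)
    have h2 : (((i + t + (j + t)).choose (i + t) : ℕ) : ℝ) ≠ 0 := by
      exact_mod_cast (Nat.choose_pos (Nat.le_add_right _ _)).ne'
    rw [Real.mul_self_sqrt (by positivity), ← h1]
    field_simp
  have he : Real.exp (x ^ 2) * Real.exp (-x ^ 2) = 1 := by rw [← Real.exp_add]; simp
  rw [momentCoeff, hch, momentWeight, waveFunction_eq, hw, hN]
  have g3 : 0 < √((i + j + 2 * t).factorial : ℝ) := by positivity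
  have g4 : 0 < √((2 : ℝ) ^ (i + j + 2 * t)) := by positivity
  have g5 : (0 : ℝ) < (t.factorial : ℝ) := by positivity
  field_simp
  linear_combination (-Polynomial.eval (√2 * x) (hermiteH (i + j + 2 * t))) * he

lemma momentCoeff_comm (k l : ℕ) (x : ℝ) : momentCoeff k l x = momentCoeff l k x := by
  rw [momentCoeff, momentCoeff, add_comm l k, Nat.choose_symm_add]

lemma summable_abs_momentCoeff_mul_pow (i j : ℕ) (x : ℝ) {w : ℝ} (hw0 : 0 < w) (hw2 : w < 2) :
    Summable fun t : ℕ => |momentCoeff (i + t) (j + t) x / t.factorial| * w ^ t := by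
  -- The index i + j + 2t grows by two per term, so ψ contributes ρ^{2t}; this choice has ρ > 1 and
  -- ρ²w = (2+w)/2 < 2.
  set ρ := √((2 / w + 1) / 2) with hρ
  have h1 : 1 < 2 / w := by rw [lt_div_iff₀ hw0]; linarith
  have hρ1 : 1 < ρ := by
    rw [hρ, Real.lt_sqrt (by norm_num)]; linarith
  have hρ2 : ρ ^ 2 * w = (2 + w) / 2 := by
    rw [hρ, Real.sq_sqrt (by positivity)]; field_simp
  obtain ⟨K, hK0, hK⟩ := exists_abs_waveFunction_le x hρ1
  have h0 := waveNorm_pos 0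
  refine Summable.of_nonneg_of_le (fun t => by positivity) (fun t => ?_)
    ((summable_momentWeight_mul_pow i j (z := ρ ^ 2 * w) (by positivity)
      (by rw [hρ2]; linarith)).mul_left ((waveNorm 0)⁻¹ * Real.exp (x ^ 2) * K * ρ ^ (i + j)))
  rw [momentCoeff_div_factorial, abs_mul, abs_mul, abs_of_pos (momentWeight_pos i j t),
    abs_of_pos (by positivity : 0 < (waveNorm 0)⁻¹ * Real.exp (x ^ 2))]
  have hmw := (momentWeight_pos i j t).le
  calc momentWeight i j t * ((waveNorm 0)⁻¹ * Real.exp (x ^ 2)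
        * |waveFunction (i + j + 2 * t) x|) * w ^ t
      ≤ momentWeight i j t * ((waveNorm 0)⁻¹ * Real.exp (x ^ 2)
        * (K * ρ ^ (i + j + 2 * t))) * w ^ t := by
        gcongr
        exact hK _
    _ = _ := by rw [pow_add, pow_mul, mul_pow]; ring

lemma summable_abs_momentCoeff (i j : ℕ) (x : ℝ) :
    Summable fun t : ℕ => |momentCoeff (i + t) (j + t) x / t.factorial| := by
  simpa using summable_abs_momentCoeff_mul_pow i j x one_pos one_lt_two

/-! ### The dual built on the normally ordered moments -/

/-- The `t`-th term of `⟨i| G†(x,0) |j⟩`. -/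
def momentDualTerm (i j t : ℕ) (x : ℝ) : ℝ :=
  (-1 : ℝ) ^ t / ((t.factorial : ℝ) * √((i.factorial : ℝ) * (j.factorial : ℝ)))
    * momentCoeff (i + t) (j + t) x

lemma momentDualTerm_eq (i j t : ℕ) (x : ℝ) :
    momentDualTerm i j t x = (√((i.factorial : ℝ) * (j.factorial : ℝ)))⁻¹
      * ((-1) ^ t * (momentCoeff (i + t) (j + t) x / t.factorial)) := by
  rw [momentDualTerm]
  field_simp

lemma summable_momentDualTerm (i j : ℕ) (x : ℝ) : Summable fun t => momentDualTerm i j t x := by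
  simp only [momentDualTerm_eq]
  refine Summable.mul_left _ (Summable.of_norm ?_)
  simpa [abs_mul, abs_div] using summable_abs_momentCoeff i j x

/-- The family `G(x,φ)`. -/
def quadDual (x φ : ℝ) : Matrix ℕ ℕ ℂ :=
  Matrix.of fun p q => Complex.exp (Complex.I * φ * ((p : ℂ) - q))
    * ((∑' t, momentDualTerm q p t x : ℝ) : ℂ)

lemma quadDual_eq_phaseRotate (x φ : ℝ) : quadDual x φ = phaseRotate φ (quadDual x 0) := by
  ext p q
  simp only [quadDual, phaseRotate, Matrix.of_apply, Complex.ofReal_zero, mul_zero, zero_mul,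
    Complex.exp_zero, one_mul]
  rw [mul_right_comm (Complex.exp (Complex.I * φ * p)), ← Complex.exp_add]
  congr 2
  ring

lemma conj_quadDual (x φ : ℝ) (i j : ℕ) :
    (starRingEnd ℂ) (quadDual x φ i j) = Complex.exp (Complex.I * φ * ((j : ℂ) - i))
      * ((∑' t, momentDualTerm j i t x : ℝ) : ℂ) := by
  rw [quadDual, Matrix.of_apply, map_mul, Complex.conj_ofReal, ← Complex.exp_conj]
  congr 2
  simp only [map_mul, map_sub, Complex.conj_I, Complex.conj_ofReal, map_natCast]
  ring

lemma conjTranspose_quadDual (x φ : ℝ) (i j : ℕ) :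
    (quadDual x φ).conjTranspose i j = Complex.exp (Complex.I * φ * ((i : ℂ) - j))
      * ((∑' t, momentDualTerm i j t x : ℝ) : ℂ) := by
  rw [Matrix.conjTranspose_apply]
  exact conj_quadDual x φ j i

lemma momentDual_add (i j t : ℕ) :
    momentDual (i + t) (j + t) i j
      = (((-1) ^ t / ((t.factorial : ℝ) * √((i.factorial : ℝ) * (j.factorial : ℝ))) : ℝ) : ℂ) := by
  rw [momentDual, Matrix.sum_apply, Finset.sum_eq_single t]
  · simp
  · intro s hs hst
    simp only [Finset.mem_range] at hs
    have : ¬ (i + t - s = i ∧ j + t - s = j) := by omega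
    rw [Matrix.smul_apply, Matrix.single_apply, if_neg this, smul_zero]
  · intro h
    simp only [Finset.mem_range] at h
    omega

lemma momentDual_eq_zero {i j k l : ℕ} (h : ∀ t, (k, l) ≠ (i + t, j + t)) :
    momentDual k l i j = 0 := by
  rw [momentDual, Matrix.sum_apply]
  refine Finset.sum_eq_zero fun s hs => ?_
  simp only [Finset.mem_range] at hs
  have : ¬ (k - s = i ∧ l - s = j) := fun ⟨h1, h2⟩ =>
    h s (by rw [Prod.mk.injEq]; omega)
  rw [Matrix.smul_apply, Matrix.single_apply, if_neg this, smul_zero]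

lemma hasSum_of_support_singleton {ι E : Type*} [AddCommMonoid E] [TopologicalSpace E] {f : ι → E}
    {a : E} (b : ι) (hb : f b = a) (h : ∀ b', b' ≠ b → f b' = 0) : HasSum f a :=
  hb ▸ hasSum_single b h

lemma injective_add_pair (i j : ℕ) : Function.Injective fun t : ℕ => (i + t, j + t) :=
  fun a b h => by simpa using (Prod.ext_iff.1 h).1

/-- For a fixed matrix element only the pairs (i+t, j+t) contribute, so the double series collapses
to the simple one defining `quadDual`. -/
lemma hasSum_momentDual (x : ℝ) (i j : ℕ) :
    HasSum (fun kl : ℕ × ℕ => momentDual kl.1 kl.2 i j * (momentCoeff kl.1 kl.2 x : ℂ))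
      ((quadDual x 0).conjTranspose i j) := by
  rw [conjTranspose_quadDual]
  simp only [Complex.ofReal_zero, mul_zero, zero_mul, Complex.exp_zero, one_mul]
  refine ((injective_add_pair i j).hasSum_iff ?_).1 ?_
  · rintro ⟨k, l⟩ hkl
    rw [momentDual_eq_zero fun t ht => hkl ⟨t, ht.symm⟩, zero_mul]
  · convert! Complex.hasSum_ofReal.2 (summable_momentDualTerm i j x).hasSum using 1
    ext t
    simp only [Function.comp, momentDual_add, momentDualTerm]
    push_cast
    rfl

/-- The expansion of (1-1)^K/K!. Biorthogonality and completeness both reduce to it. -/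
lemma sum_neg_one_pow_div_factorial (K : ℕ) :
    ∑ t ∈ Finset.range (K + 1), (-1 : ℝ) ^ t / ((t.factorial : ℝ) * ((K - t).factorial : ℝ))
      = if K = 0 then 1 else 0 := by
  have h := Int.alternating_sum_range_choose (n := K)
  have h2 : (∑ t ∈ Finset.range (K + 1), (-1 : ℝ) ^ t * (K.choose t : ℝ))
      = if K = 0 then 1 else 0 := by exact_mod_cast h
  have h3 : ∑ t ∈ Finset.range (K + 1), (-1 : ℝ) ^ t / ((t.factorial : ℝ) * ((K - t).factorial : ℝ))
      = (K.factorial : ℝ)⁻¹ * ∑ t ∈ Finset.range (K + 1), (-1 : ℝ) ^ t * (K.choose t : ℝ) := by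
    rw [Finset.mul_sum]
    refine Finset.sum_congr rfl fun t ht => ?_
    have ht' : t ≤ K := by simp at ht; omega
    have := Nat.choose_mul_factorial_mul_factorial ht'
    rw [← this]
    have hc : (K.choose t : ℝ) ≠ 0 := by exact_mod_cast (Nat.choose_pos ht').ne'
    push_cast
    field_simp
  rw [h3, h2]
  split_ifs with h0
  · simp [h0]
  · simp

lemma fockTrace_phaseRotate_momentDual (φ : ℝ) (k l : ℕ) (A : Matrix ℕ ℕ ℂ) :
    fockTrace (phaseRotate φ (momentDual k l)) A
      = Complex.exp (Complex.I * φ * ((k : ℂ) - l)) * ∑ t ∈ Finset.range (min k l + 1),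
        (((-1) ^ t / ((t.factorial : ℝ) * √(((k - t).factorial : ℝ) * ((l - t).factorial : ℝ))) : ℝ)
          : ℂ) * A (l - t) (k - t) := by
  rw [Finset.mul_sum]
  refine HasSum.tsum_eq ?_
  have h : ∀ t ∈ Finset.range (min k l + 1), HasSum (fun p : ℕ × ℕ =>
      Complex.exp (Complex.I * φ * p.1) * ((((-1) ^ t / ((t.factorial : ℝ)
        * √(((k - t).factorial : ℝ) * ((l - t).factorial : ℝ))) : ℝ) : ℂ)
        * Matrix.single (k - t) (l - t) (1 : ℂ) p.1 p.2)
        * Complex.exp (-(Complex.I * φ * p.2)) * A p.2 p.1)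
      (Complex.exp (Complex.I * φ * ((k : ℂ) - l)) * ((((-1) ^ t / ((t.factorial : ℝ)
        * √(((k - t).factorial : ℝ) * ((l - t).factorial : ℝ))) : ℝ) : ℂ)
        * A (l - t) (k - t))) := fun t ht => by
    have ht' : t ≤ k ∧ t ≤ l := by simp at ht; omega
    refine hasSum_of_support_singleton (k - t, l - t) ?_ ?_
    · have : Complex.exp (Complex.I * φ * ((k : ℂ) - l))
          = Complex.exp (Complex.I * φ * ((k - t : ℕ) : ℂ))
            * Complex.exp (-(Complex.I * φ * ((l - t : ℕ) : ℂ))) := by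
        rw [← Complex.exp_add]; congr 1; push_cast [Nat.cast_sub ht'.1, Nat.cast_sub ht'.2]; ring
      rw [this]
      simp only [Matrix.single_apply, and_self, if_true]
      ring
    · rintro ⟨a, b⟩ hab
      have : ¬ (k - t = a ∧ l - t = b) := fun ⟨h1, h2⟩ => hab (by rw [h1, h2])
      simp only [Matrix.single_apply, if_neg this]
      ring
  convert! hasSum_sum h using 1
  ext p
  simp only [phaseRotate, Matrix.of_apply, momentDual, Matrix.sum_apply, Matrix.smul_apply,
    smul_eq_mul, Finset.mul_sum, Finset.sum_mul]

/-- A term can survive only if (k,l) = (m+K, n+K). The square roots in g_{k,l} then cancel those of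
the moment, leaving the alternating sum of order K. -/
lemma fockTrace_momentDual_moment (φ : ℝ) (k l n m : ℕ) :
    fockTrace (phaseRotate φ (momentDual k l)) (fockMatrix (creation ^ n * annihilation ^ m))
      = if (k, l) = (m, n) then Complex.exp (Complex.I * φ * ((m : ℂ) - n)) else 0 := by
  rw [fockTrace_phaseRotate_momentDual]
  by_cases hK : ∃ K, k = m + K ∧ l = n + K
  · obtain ⟨K, rfl, rfl⟩ := hK
    have hsub : Finset.range (K + 1) ⊆ Finset.range (min (m + K) (n + K) + 1) := by
      intro t; simp only [Finset.mem_range]; omega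
    -- For t > K the column index m + K - t lies below m, and aᵐ annihilates that state.
    rw [← Finset.sum_subset hsub]
    · have h : ∀ t ∈ Finset.range (K + 1), (((-1) ^ t / ((t.factorial : ℝ)
            * √(((m + K - t).factorial : ℝ) * ((n + K - t).factorial : ℝ))) : ℝ) : ℂ)
            * fockMatrix (creation ^ n * annihilation ^ m) (n + K - t) (m + K - t)
          = (((-1 : ℝ) ^ t / ((t.factorial : ℝ) * ((K - t).factorial : ℝ)) : ℝ) : ℂ) := by
        intro t ht
        obtain ⟨s, rfl⟩ : ∃ s, K = t + s := ⟨K - t, by simp at ht; omega⟩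
        rw [show m + (t + s) - t = m + s by omega, show n + (t + s) - t = n + s by omega,
          show t + s - t = s by omega, fockMatrix_moment_add, if_pos rfl, ← Complex.ofReal_mul]
        congr 1
        rw [Real.sqrt_mul (by positivity)]
        have h1 : 0 < √((m + s).factorial : ℝ) := by positivity
        have h2 : 0 < √((n + s).factorial : ℝ) := by positivity
        field_simp
      rw [Finset.sum_congr rfl h, ← Complex.ofReal_sum, sum_neg_one_pow_div_factorial]
      by_cases hK0 : K = 0
      · subst hK0; simp
      · simp [hK0]
    · intro t hmem ht
      simp only [Finset.mem_range] at hmem ht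
      rw [fockMatrix_moment_of_lt (by omega), mul_zero]
  · rw [if_neg, Finset.sum_eq_zero, mul_zero]
    · intro t ht
      simp only [Finset.mem_range] at ht
      by_cases h : k - t < m
      · rw [fockMatrix_moment_of_lt h, mul_zero]
      · obtain ⟨s, hs⟩ : ∃ s, k - t = m + s := ⟨k - t - m, by omega⟩
        rw [hs, fockMatrix_moment_add, if_neg, mul_zero]
        intro h2
        exact hK ⟨s + t, by omega, by omega⟩
    · intro h
      rw [Prod.mk.injEq] at h
      exact hK ⟨0, by omega, by omega⟩

lemma hasSum_fockTrace_momentDual (x φ : ℝ) (n m : ℕ) :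
    HasSum (fun kl : ℕ × ℕ => (momentCoeff kl.1 kl.2 x : ℂ)
        * fockTrace (phaseRotate φ (momentDual kl.1 kl.2))
            (fockMatrix (creation ^ n * annihilation ^ m)))
      (momentEstimator n m x φ) := by
  simp only [fockTrace_momentDual_moment]
  refine hasSum_of_support_singleton (m, n) ?_ ?_
  · simp [momentEstimator, momentCoeff_comm n m]
  · rintro ⟨k, l⟩ hkl
    simp only [if_neg hkl, mul_zero]

/-! ### Pattern functions -/

lemma fockTrace_single (M : Matrix ℕ ℕ ℂ) (i j : ℕ) :
    fockTrace M (Matrix.single i j 1) = M j i := by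
  refine HasSum.tsum_eq (hasSum_of_support_singleton (j, i) (by simp) ?_)
  rintro ⟨a, b⟩ hab
  have : ¬ (i = b ∧ j = a) := fun ⟨h1, h2⟩ => hab (by rw [h1, h2])
  simp only [Matrix.single_apply, if_neg this, mul_zero]

lemma hasSum_patternFunction (x φ : ℝ) (i j : ℕ) :
    HasSum (fun t : ℕ =>
        (((-1 : ℝ) ^ t / ((t.factorial : ℝ) * √((i.factorial : ℝ) * (j.factorial : ℝ)))
          * momentCoeff (j + t) (i + t) x : ℝ) : ℂ)
        * Complex.exp (Complex.I * φ * ((j : ℂ) - (i : ℂ))))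
      (fockTrace (quadDual x φ).conjTranspose (Matrix.single i j 1)) := by
  rw [fockTrace_single, conjTranspose_quadDual, mul_comm (Complex.exp _)]
  refine HasSum.mul_right _ ?_
  convert! Complex.hasSum_ofReal.2 (summable_momentDualTerm j i x).hasSum using 1
  ext t
  rw [momentDualTerm, mul_comm (i.factorial : ℝ)]

lemma hasSum_vacuumPatternFunction (x φ : ℝ) :
    HasSum (fun k : ℕ =>
        (((-1 / 2 : ℝ) ^ k * ((k.factorial : ℝ) / ((2 * k).factorial : ℝ))
          * (hermiteH (2 * k)).eval (√2 * x) : ℝ) : ℂ))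
      (fockTrace (quadDual x φ).conjTranspose (Matrix.single 0 0 1)) := by
  convert! hasSum_patternFunction x φ 0 0 using 1
  ext k
  have h1 : ((k.factorial : ℝ)) ≠ 0 := by positivity
  have h2 : (((k + k).choose k : ℕ) : ℝ) * k.factorial * k.factorial = (2 * k).factorial := by
    rw [two_mul]
    exact_mod_cast Nat.add_choose_mul_factorial_mul_factorial k k
  have h3 : (((k + k).choose k : ℕ) : ℝ) ≠ 0 := by
    exact_mod_cast (Nat.choose_pos (Nat.le_add_right _ _)).ne'
  have h4 : √((2 : ℝ) ^ (k + k)) = 2 ^ k := by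
    rw [pow_add, Real.sqrt_mul_self (by positivity)]
  simp only [Nat.cast_zero, sub_zero, mul_zero, Complex.exp_zero, mul_one, zero_add,
    Nat.factorial_zero, Nat.cast_one, Real.sqrt_one, momentCoeff, h4]
  congr 1
  rw [← h2, ← two_mul, div_pow]
  field_simp

/-! ### Abel traces of the moments -/

/-- On the antidiagonal s + t = N the absolute values add up, by the binomial theorem, to
|c_N|(1+r)^N/N!. -/
lemma summable_binomial_of_summable {c : ℕ → ℝ} {r : ℝ} (hr : 0 ≤ r)
    (h : Summable fun N : ℕ => |c N / N.factorial| * (1 + r) ^ N) :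
    Summable fun p : ℕ × ℕ => r ^ p.1 / (p.1.factorial : ℝ)
      * ((-1) ^ p.2 / (p.2.factorial : ℝ) * c (p.1 + p.2)) := by
  refine Summable.of_norm ?_
  rw [← (Finset.HasAntidiagonal.sigmaAntidiagonalEquivProd (A := ℕ)).summable_iff]
  refine (summable_sigma_of_nonneg fun _ => norm_nonneg _).2
    ⟨fun N => (hasSum_fintype _).summable, h.congr fun N => ?_⟩
  rw [tsum_fintype, add_comm 1 r, add_pow, Finset.mul_sum]
  refine Eq.trans ?_ (Finset.sum_coe_sort (Finset.HasAntidiagonal.antidiagonal N)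
    (fun p : ℕ × ℕ => ‖r ^ p.1 / (p.1.factorial : ℝ)
      * ((-1) ^ p.2 / (p.2.factorial : ℝ) * c (p.1 + p.2))‖)).symm
  rw [Finset.Nat.sum_antidiagonal_eq_sum_range_succ_mk]
  refine Finset.sum_congr rfl fun s hs => ?_
  obtain ⟨t, rfl⟩ : ∃ t, N = s + t := ⟨N - s, by simp at hs; omega⟩
  have h1 : ((s + t).choose s : ℝ) * s.factorial * t.factorial = (s + t).factorial := by
    rw [Nat.choose_symm_add]
    exact_mod_cast Nat.add_choose_mul_factorial_mul_factorial s t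
  have h2 : ((s + t).choose s : ℝ) ≠ 0 := by
    exact_mod_cast (Nat.choose_pos (Nat.le_add_right _ _)).ne'
  simp only [Nat.add_sub_cancel_left, Real.norm_eq_abs, abs_mul, abs_div, abs_pow, abs_neg, abs_one,
    one_pow, Nat.abs_cast, abs_of_nonneg hr]
  rw [← h1]
  have e1 : (s.factorial : ℝ) ≠ 0 := by positivity
  have e2 : (t.factorial : ℝ) ≠ 0 := by positivity
  field_simp

/-- The same regrouping with the signs kept turns (1+r)^N into (r-1)^N, so all terms but N = 0
disappear as r → 1. -/
lemma hasSum_binomial_of_summable {c : ℕ → ℝ} {r : ℝ} (hr : 0 ≤ r)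
    (h : Summable fun N : ℕ => |c N / N.factorial| * (1 + r) ^ N) :
    HasSum (fun s : ℕ => r ^ s / (s.factorial : ℝ)
        * ∑' t : ℕ, (-1) ^ t / (t.factorial : ℝ) * c (s + t))
      (∑' N : ℕ, c N / N.factorial * (r - 1) ^ N) := by
  have hs := summable_binomial_of_summable hr h
  have h1 := hs.hasSum.prod_fiberwise fun s => (hs.prod_factor s).hasSum
  have h2 := (hasSum_sum_antidiagonal hs.hasSum).tsum_eq
  simp only [tsum_mul_left] at h1
  convert! h1 using 1
  rw [← h2]
  refine tsum_congr fun N => ?_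
  rw [Finset.Nat.sum_antidiagonal_eq_sum_range_succ_mk, sub_eq_add_neg, add_pow, Finset.mul_sum]
  refine Finset.sum_congr rfl fun s hs => ?_
  obtain ⟨t, rfl⟩ : ∃ t, N = s + t := ⟨N - s, by simp at hs; omega⟩
  have h1 : ((s + t).choose s : ℝ) * s.factorial * t.factorial = (s + t).factorial := by
    rw [Nat.choose_symm_add]
    exact_mod_cast Nat.add_choose_mul_factorial_mul_factorial s t
  have h2 : ((s + t).choose s : ℝ) ≠ 0 := by
    exact_mod_cast (Nat.choose_pos (Nat.le_add_right _ _)).ne'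
  simp only [Nat.add_sub_cancel_left]
  rw [← h1]
  have e1 : (s.factorial : ℝ) ≠ 0 := by positivity
  have e2 : (t.factorial : ℝ) ≠ 0 := by positivity
  field_simp

lemma tendsto_tsum_mul_sub_one_pow {c : ℕ → ℝ} (h : Summable fun N => |c N|) :
    Tendsto (fun r : ℝ => ∑' N : ℕ, c N * (r - 1) ^ N) (𝓝[<] 1) (𝓝 (c 0)) := by
  have h0 : ∑' N : ℕ, c N * (1 - 1 : ℝ) ^ N = c 0 := by
    rw [tsum_eq_single 0]
    · simp
    · intro N hN; simp [hN]
  rw [← h0]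
  refine tendsto_tsum_of_dominated_convergence h (fun N => ?_) ?_
  · have : Continuous fun r : ℝ => c N * (r - 1) ^ N := by fun_prop
    exact (this.tendsto 1).mono_left nhdsWithin_le_nhds
  · filter_upwards [Ioo_mem_nhdsLT (show (0 : ℝ) < 1 by norm_num)] with r hr N
    rw [norm_mul, norm_pow, Real.norm_eq_abs, Real.norm_eq_abs]
    refine mul_le_of_le_one_right (abs_nonneg _) (pow_le_one₀ (abs_nonneg _) ?_)
    rw [abs_le]
    constructor <;> linarith [hr.1, hr.2]

/-- A trace against the moment `a†ⁿaᵐ` is a sum along one diagonal. -/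
lemma hasSum_weighted_trace_moment_iff (M : Matrix ℕ ℕ ℂ) (n m : ℕ) (r L : ℂ) :
    HasSum (fun p : ℕ × ℕ => r ^ p.1
        * (M p.1 p.2 * fockMatrix (creation ^ n * annihilation ^ m) p.2 p.1)) L
      ↔ HasSum (fun s : ℕ => r ^ (m + s) * (M (m + s) (n + s)
        * ((√((n + s).factorial : ℝ) * √((m + s).factorial : ℝ) / s.factorial : ℝ) : ℂ))) L := by
  rw [← (injective_add_pair m n).hasSum_iff]
  · refine Eq.to_iff (congrArg (fun f => HasSum f L) ?_)
    ext s
    simp only [Function.comp]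
    rw [fockMatrix_moment_add, if_pos rfl]
  · rintro ⟨i, j⟩ hij
    by_cases h : i < m
    · simp [fockMatrix_moment_of_lt h]
    · obtain ⟨s, rfl⟩ : ∃ s, i = m + s := ⟨i - m, by omega⟩
      simp only
      rw [fockMatrix_moment_add, if_neg, mul_zero, mul_zero]
      rintro rfl
      exact hij ⟨s, rfl⟩

/-- Along the diagonal (m+s, n+s) the phase is constant and the square roots cancel, leaving r^s/s!
times an alternating series: the shape of `hasSum_binomial_of_summable`. -/
lemma hasSum_weighted_trace_quadDual (x φ : ℝ) (n m : ℕ) {r : ℝ} (hr0 : 0 < r) (hr1 : r < 1) :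
    HasSum (fun p : ℕ × ℕ => (r : ℂ) ^ p.1
        * ((quadDual x φ).conjTranspose p.1 p.2
          * fockMatrix (creation ^ n * annihilation ^ m) p.2 p.1))
      ((r : ℂ) ^ m * Complex.exp (Complex.I * φ * ((m : ℂ) - n))
        * ((∑' N : ℕ, momentCoeff (m + N) (n + N) x / N.factorial * (r - 1) ^ N : ℝ) : ℂ)) := by
  rw [hasSum_weighted_trace_moment_iff]
  have h := hasSum_binomial_of_summable (c := fun N => momentCoeff (m + N) (n + N) x) hr0.le
    (summable_abs_momentCoeff_mul_pow m n x (by linarith) (by linarith))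
  convert! (Complex.hasSum_ofReal.2 h).mul_left
    ((r : ℂ) ^ m * Complex.exp (Complex.I * φ * ((m : ℂ) - n))) using 1
  ext s
  have e : ∑' t, momentDualTerm (m + s) (n + s) t x
      = (√((m + s).factorial : ℝ) * √((n + s).factorial : ℝ))⁻¹
        * ∑' t : ℕ, (-1) ^ t / (t.factorial : ℝ) * momentCoeff (m + (s + t)) (n + (s + t)) x := by
    rw [← tsum_mul_left]
    refine tsum_congr fun t => ?_
    rw [momentDualTerm_eq, Real.sqrt_mul (by positivity), add_assoc, add_assoc]
    ring
  have e1 : √((m + s).factorial : ℝ) ≠ 0 := by positivity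
  have e2 : √((n + s).factorial : ℝ) ≠ 0 := by positivity
  have e3 : (s.factorial : ℝ) ≠ 0 := by positivity
  have key : (∑' t, momentDualTerm (m + s) (n + s) t x)
        * (√((n + s).factorial : ℝ) * √((m + s).factorial : ℝ) / s.factorial)
      = (s.factorial : ℝ)⁻¹
        * ∑' t : ℕ, (-1) ^ t / (t.factorial : ℝ) * momentCoeff (m + (s + t)) (n + (s + t)) x := by
    rw [e]
    field_simp
  have key' := congrArg (fun y : ℝ => (y : ℂ)) key
  simp only [Complex.ofReal_mul (∑' t, momentDualTerm (m + s) (n + s) t x)] at key'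
  rw [conjTranspose_quadDual, mul_assoc, key', pow_add]
  have e4 : Complex.exp (Complex.I * φ * (((m + s : ℕ) : ℂ) - ((n + s : ℕ) : ℂ)))
      = Complex.exp (Complex.I * φ * ((m : ℂ) - n)) := by
    congr 1; push_cast; ring
  rw [e4]
  simp only [Complex.ofReal_mul, Complex.ofReal_div, Complex.ofReal_inv, Complex.ofReal_pow]
  ring

lemma hasAbelTrace_quadDual (x φ : ℝ) (n m : ℕ) :
    HasAbelTrace (quadDual x φ).conjTranspose (fockMatrix (creation ^ n * annihilation ^ m))
      (momentEstimator n m x φ) := by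
  refine ⟨fun r hr0 hr1 => (hasSum_weighted_trace_quadDual x φ n m hr0 hr1).summable, ?_⟩
  have h1 := tendsto_tsum_mul_sub_one_pow
    (c := fun N => momentCoeff (m + N) (n + N) x / N.factorial) (summable_abs_momentCoeff m n x)
  have h2 : Tendsto (fun r : ℝ => (r : ℂ) ^ m * Complex.exp (Complex.I * φ * ((m : ℂ) - n)))
      (𝓝[<] 1) (𝓝 (((1 : ℝ) : ℂ) ^ m * Complex.exp (Complex.I * φ * ((m : ℂ) - n)))) := by
    have : Continuous fun r : ℝ =>
      (r : ℂ) ^ m * Complex.exp (Complex.I * φ * ((m : ℂ) - n)) := by fun_prop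
    exact (this.tendsto 1).mono_left nhdsWithin_le_nhds
  have h3 := h2.mul ((Complex.continuous_ofReal.tendsto _).comp h1)
  have e : momentEstimator n m x φ
      = ((1 : ℝ) : ℂ) ^ m * Complex.exp (Complex.I * φ * ((m : ℂ) - n))
        * ((momentCoeff (m + 0) (n + 0) x / (Nat.factorial 0 : ℝ) : ℝ) : ℂ) := by
    simp [momentEstimator, momentCoeff_comm n m, mul_comm]
  rw [e]
  refine h3.congr' ?_
  filter_upwards [Ioo_mem_nhdsLT (show (0 : ℝ) < 1 by norm_num)] with r hr
  exact (hasSum_weighted_trace_quadDual x φ n m hr.1 hr.2).tsum_eq.symm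

/-! ### Duality -/

lemma integrable_tsum_of_summable_integral_norm {α : Type*} [MeasurableSpace α] {μ : Measure α}
    {F : ℕ → α → ℝ} (hF : ∀ t, Integrable (F t) μ) (hsum : Summable fun t => ∫ a, ‖F t a‖ ∂μ)
    (hpt : ∀ a, Summable fun t => F t a) : Integrable (fun a => ∑' t, F t a) μ := by
  refine ⟨aestronglyMeasurable_of_tendsto_ae atTop
    (f := fun n a => ∑ t ∈ Finset.range n, F t a) (fun n => ?_)
    (ae_of_all _ fun a => (hpt a).hasSum.tendsto_sum_nat), ?_⟩
  · exact (integrable_finsetSum _ fun t _ => hF t).1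
  · have h1 : ∫⁻ a, ‖∑' t, F t a‖ₑ ∂μ ≤ ∫⁻ a, ∑' t, ‖F t a‖ₑ ∂μ :=
      lintegral_mono fun a => enorm_tsum_le_tsum_enorm
    refine lt_of_le_of_lt h1 ?_
    rw [lintegral_tsum fun t => (hF t).1.enorm]
    have h2 : ∀ t, ∫⁻ a, ‖F t a‖ₑ ∂μ = ENNReal.ofReal (∫ a, ‖F t a‖ ∂μ) := fun t =>
      (ofReal_integral_norm_eq_lintegral_enorm (hF t)).symm
    simp only [h2]
    rw [← ENNReal.ofReal_tsum_of_nonneg (fun t => integral_nonneg fun _ => norm_nonneg _) hsum]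
    exact ENNReal.ofReal_lt_top

lemma integrable_waveFunction_mul_mul (p q n : ℕ) :
    Integrable fun x : ℝ =>
      waveFunction p x * waveFunction q x * (Real.exp (x ^ 2) * waveFunction n x) := by
  obtain ⟨P, hP⟩ := exists_waveFunction_eq_polynomial n
  refine (integrable_polynomial_mul_waveFunction_mul P p q).congr (ae_of_all _ fun x => ?_)
  have he : Real.exp (x ^ 2) * Real.exp (-x ^ 2) = 1 := by rw [← Real.exp_add]; simp
  simp only [hP]
  linear_combination (-(waveFunction p x * waveFunction q x * P.eval x)) * he

/-- The uniformity in n comes from |uv| ≤ (u²+v²)/2 with v = ψ_n of norm 1 and u = ψ_pψ_q e^{x²},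
which is a polynomial times e^{-x²} and hence square integrable. -/
lemma exists_integral_abs_waveFunction_mul_mul_le (p q : ℕ) :
    ∃ B : ℝ, ∀ n, ∫ x : ℝ,
      |waveFunction p x * waveFunction q x * (Real.exp (x ^ 2) * waveFunction n x)| ≤ B := by
  set g : ℝ → ℝ := fun x => (waveFunction p x * waveFunction q x * Real.exp (x ^ 2)) ^ 2 with hg
  have hgi : Integrable g := by
    obtain ⟨P, hP⟩ := exists_waveFunction_eq_polynomial p
    obtain ⟨Q, hQ⟩ := exists_waveFunction_eq_polynomial q
    refine (integrable_polynomial_mul_gaussian ((P * Q) ^ 2) (b := 2) (by norm_num)).congr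
      (ae_of_all _ fun x => ?_)
    have he : Real.exp (-2 * x ^ 2)
        = (Real.exp (-x ^ 2) * Real.exp (-x ^ 2) * Real.exp (x ^ 2)) ^ 2 := by
      rw [← Real.exp_add, ← Real.exp_add, ← Real.exp_nat_mul]; congr 1; push_cast; ring
    simp only [hg, hP, hQ, he, Polynomial.eval_pow, Polynomial.eval_mul]
    ring
  refine ⟨((∫ x, g x) + 1) * (1 / 2), fun n => ?_⟩
  have h1 : ∫ x : ℝ, waveFunction n x * waveFunction n x = 1 := by
    simp [integral_waveFunction_mul]
  have hi := (hgi.add (integrable_waveFunction_mul n n)).mul_const (1 / 2)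
  calc _ ≤ ∫ x, (g x + waveFunction n x * waveFunction n x) * (1 / 2) := by
        refine integral_mono (integrable_waveFunction_mul_mul p q n).abs hi fun x => ?_
        simp only [hg, abs_le]
        constructor <;>
          nlinarith [sq_nonneg (waveFunction p x * waveFunction q x * Real.exp (x ^ 2)
              - waveFunction n x),
            sq_nonneg (waveFunction p x * waveFunction q x * Real.exp (x ^ 2)
              + waveFunction n x)]
    _ = ((∫ x, g x) + 1) * (1 / 2) := by
        rw [integral_mul_const, integral_add hgi (integrable_waveFunction_mul n n), h1]

/-- The finite completeness relation behind the duality. -/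
lemma hasSum_momentDual_completeness (p q i j : ℕ) :
    HasSum (fun t : ℕ =>
        (((-1 : ℝ) ^ t / ((t.factorial : ℝ) * √((i.factorial : ℝ) * (j.factorial : ℝ))) : ℝ) : ℂ)
          * fockMatrix (creation ^ (i + t) * annihilation ^ (j + t)) p q)
      (if p = i ∧ q = j then 1 else 0) := by
  by_cases hS : ∃ S, p = i + S ∧ q = j + S
  · obtain ⟨S, rfl, rfl⟩ := hS
    have hfin : ∀ t, t ∉ Finset.range (S + 1) →
        (((-1 : ℝ) ^ t / ((t.factorial : ℝ) * √((i.factorial : ℝ) * (j.factorial : ℝ))) : ℝ) : ℂ)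
          * fockMatrix (creation ^ (i + t) * annihilation ^ (j + t)) (i + S) (j + S) = 0 := by
      intro t ht
      simp only [Finset.mem_range] at ht
      rw [fockMatrix_moment_of_lt (by omega), mul_zero]
    have h := hasSum_sum_of_ne_finset_zero (L := SummationFilter.unconditional ℕ) hfin
    convert! h using 1
    have hterm : ∀ t ∈ Finset.range (S + 1),
        (((-1 : ℝ) ^ t / ((t.factorial : ℝ) * √((i.factorial : ℝ) * (j.factorial : ℝ))) : ℝ) : ℂ)
          * fockMatrix (creation ^ (i + t) * annihilation ^ (j + t)) (i + S) (j + S)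
        = ((√((i + S).factorial : ℝ) * √((j + S).factorial : ℝ)
            / (√(i.factorial : ℝ) * √(j.factorial : ℝ)) : ℝ) : ℂ)
          * (((-1 : ℝ) ^ t / ((t.factorial : ℝ) * ((S - t).factorial : ℝ)) : ℝ) : ℂ) := by
      intro t ht
      obtain ⟨s, rfl⟩ : ∃ s, S = t + s := ⟨S - t, by simp at ht; omega⟩
      rw [← add_assoc j t s, fockMatrix_moment_add, if_pos (by ring), ← Complex.ofReal_mul,
        ← Complex.ofReal_mul, Nat.add_sub_cancel_left, Real.sqrt_mul (by positivity)]
      congr 1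
      rw [← add_assoc i t s]
      have e1 : √(i.factorial : ℝ) ≠ 0 := by positivity
      have e2 : √(j.factorial : ℝ) ≠ 0 := by positivity
      field_simp
    rw [Finset.sum_congr rfl hterm, ← Finset.mul_sum, ← Complex.ofReal_sum,
      sum_neg_one_pow_div_factorial]
    by_cases hS0 : S = 0
    · subst hS0
      have e1 : √(i.factorial : ℝ) ≠ 0 := by positivity
      have e2 : √(j.factorial : ℝ) ≠ 0 := by positivity
      simp [div_self (mul_ne_zero e1 e2)]
    · simp [hS0]
  · rw [if_neg fun h => hS ⟨0, by omega, by omega⟩]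
    convert! hasSum_zero using 1
    ext t
    by_cases h : q < j + t
    · rw [fockMatrix_moment_of_lt h, mul_zero]
    · obtain ⟨s, rfl⟩ : ∃ s, q = j + t + s := ⟨q - (j + t), by omega⟩
      rw [fockMatrix_moment_add, if_neg, mul_zero]
      intro h2
      exact hS ⟨t + s, by omega, by omega⟩

/-- The `x`-dependence of `⟨p|δ(X_φ - x)|q⟩ conj ⟨i|G(x,φ)|j⟩`, term by term. -/
def dualityTerm (p q i j t : ℕ) (x : ℝ) : ℝ :=
  waveFunction p x * waveFunction q x * momentDualTerm j i t x

lemma dualityTerm_eq (p q i j t : ℕ) (x : ℝ) :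
    dualityTerm p q i j t x
      = ((√((j.factorial : ℝ) * (i.factorial : ℝ)))⁻¹ * (waveNorm 0)⁻¹ * (-1) ^ t
          * momentWeight j i t)
        * (waveFunction p x * waveFunction q x
          * (Real.exp (x ^ 2) * waveFunction (j + i + 2 * t) x)) := by
  rw [dualityTerm, momentDualTerm_eq, momentCoeff_div_factorial]
  ring

lemma integrable_dualityTerm (p q i j t : ℕ) : Integrable (dualityTerm p q i j t) := by
  have h := (integrable_waveFunction_mul_mul p q (j + i + 2 * t)).const_mul
    ((√((j.factorial : ℝ) * (i.factorial : ℝ)))⁻¹ * (waveNorm 0)⁻¹ * (-1) ^ t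
          * momentWeight j i t)
  exact h.congr (ae_of_all _ fun x => (dualityTerm_eq p q i j t x).symm)

lemma summable_integral_norm_dualityTerm (p q i j : ℕ) :
    Summable fun t => ∫ x, ‖dualityTerm p q i j t x‖ := by
  obtain ⟨B, hB⟩ := exists_integral_abs_waveFunction_mul_mul_le p q
  have h0 := waveNorm_pos 0
  have hs : Summable fun t => momentWeight j i t := by
    simpa using summable_momentWeight_mul_pow j i one_pos one_lt_two
  refine Summable.of_nonneg_of_le (fun t => integral_nonneg fun _ => norm_nonneg _) (fun t => ?_)
    (hs.mul_left ((√((j.factorial : ℝ) * (i.factorial : ℝ)))⁻¹ * (waveNorm 0)⁻¹ * B))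
  have hw := momentWeight_pos j i t
  have e : ∀ x, ‖dualityTerm p q i j t x‖
      = ((√((j.factorial : ℝ) * (i.factorial : ℝ)))⁻¹ * (waveNorm 0)⁻¹ * momentWeight j i t)
        * |waveFunction p x * waveFunction q x
          * (Real.exp (x ^ 2) * waveFunction (j + i + 2 * t) x)| := fun x => by
    rw [dualityTerm_eq, Real.norm_eq_abs, abs_mul]
    congr 1
    rw [abs_mul, abs_mul, abs_mul, abs_pow, abs_neg, abs_one, one_pow, abs_of_pos hw,
      abs_of_pos (by positivity : 0 < (waveNorm 0)⁻¹),
      abs_of_pos (by positivity : 0 < (√((j.factorial : ℝ) * (i.factorial : ℝ)))⁻¹)]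
    ring
  simp only [e]
  rw [integral_const_mul]
  calc _ ≤ ((√((j.factorial : ℝ) * (i.factorial : ℝ)))⁻¹ * (waveNorm 0)⁻¹ * momentWeight j i t)
        * B := by
        gcongr
        exact hB _
    _ = _ := by ring

lemma summable_dualityTerm (p q i j : ℕ) (x : ℝ) : Summable fun t => dualityTerm p q i j t x :=
  (summable_momentDualTerm j i x).mul_left _

lemma quadProj_mul_conj_quadDual (x φ : ℝ) (p q i j : ℕ) :
    quadProj x φ p q * (starRingEnd ℂ) (quadDual x φ i j)
      = Complex.exp (Complex.I * φ * ((p : ℂ) - q + j - i))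
        * ((∑' t, dualityTerm p q i j t x : ℝ) : ℂ) := by
  have : Complex.exp (Complex.I * φ * ((p : ℂ) - q + j - i))
      = Complex.exp (Complex.I * φ * ((p : ℂ) - q)) * Complex.exp (Complex.I * φ * ((j : ℂ) - i))
      := by
    rw [← Complex.exp_add]; congr 1; ring
  rw [quadProj_apply, conj_quadDual, this]
  simp only [dualityTerm, tsum_mul_left]
  push_cast
  ring

lemma integrable_quadProj_mul_conj_quadDual (p q i j : ℕ) :
    Integrable (fun z : ℝ × ℝ => quadProj z.2 z.1 p q * (starRingEnd ℂ) (quadDual z.2 z.1 i j))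
      ((volume.restrict (Set.Ioc (0 : ℝ) Real.pi)).prod volume) := by
  simp only [quadProj_mul_conj_quadDual]
  have h1 : Integrable (fun φ : ℝ => Complex.exp (Complex.I * φ * ((p : ℂ) - q + j - i)))
      (volume.restrict (Set.Ioc (0 : ℝ) Real.pi)) := by
    have hc : Continuous fun φ : ℝ => Complex.exp (Complex.I * φ * ((p : ℂ) - q + j - i)) := by
      fun_prop
    exact (hc.intervalIntegrable 0 Real.pi).1
  exact h1.mul_prod (integrable_tsum_of_summable_integral_norm (integrable_dualityTerm p q i j)
    (summable_integral_norm_dualityTerm p q i j) (summable_dualityTerm p q i j)).ofReal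

/-- The series in t may be integrated termwise. Its φ-phase does not depend on t, so the t-th term
is the estimator of a†^{i+t}a^{j+t} against the projector; Richter's expansion turns it into that
moment, and completeness sums the moments. -/
lemma integral_quadProj_mul_conj_quadDual (p q i j : ℕ) :
    (1 / (Real.pi : ℂ)) * ∫ φ in (0 : ℝ)..Real.pi, ∫ x : ℝ,
        quadProj x φ p q * (starRingEnd ℂ) (quadDual x φ i j)
      = if p = i ∧ q = j then 1 else 0 := by
  simp only [quadProj_mul_conj_quadDual, integral_const_mul, integral_complex_ofReal]
  rw [intervalIntegral.integral_mul_const]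
  have hsum := hasSum_integral_of_summable_integral_norm (integrable_dualityTerm p q i j)
    (summable_integral_norm_dualityTerm p q i j)
  have h1 := (Complex.hasSum_ofReal.2 hsum).mul_left ((1 / (Real.pi : ℂ))
    * ∫ φ in (0 : ℝ)..Real.pi, Complex.exp (Complex.I * φ * ((p : ℂ) - q + j - i)))
  rw [← mul_assoc]
  refine h1.unique ?_
  convert! hasSum_momentDual_completeness p q i j using 1
  ext t
  rw [← integral_fockMatrix_richterOperator]
  simp only [← quadFunction_momentEstimator]
  rw [mul_assoc, ← intervalIntegral.integral_mul_const, mul_left_comm]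
  congr 1
  rw [← intervalIntegral.integral_const_mul]
  refine intervalIntegral.integral_congr fun φ _ => ?_
  simp only [quadFunction, Matrix.of_apply]
  rw [← integral_complex_ofReal, ← integral_const_mul, ← integral_const_mul]
  congr 1
  ext x
  have e : Complex.exp (Complex.I * φ * ((p : ℂ) - q + j - i))
      = Complex.exp (Complex.I * φ * ((p : ℂ) - q))
        * Complex.exp (Complex.I * φ * (((j + t : ℕ) : ℂ) - ((i + t : ℕ) : ℂ))) := by
    rw [← Complex.exp_add]; congr 1; push_cast; ring
  rw [quadProj_apply, momentEstimator, e, dualityTerm, momentDualTerm, momentCoeff_comm (j + t),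
    mul_comm (j.factorial : ℝ)]
  simp only [Complex.ofReal_mul]
  ring

/-! ### The canonical dual -/

lemma continuous_charElem (p q : ℕ) : Continuous (charElem p q) := by
  refine continuous_of_dominated (bound := fun y => ‖waveFunction p y * waveFunction q y‖)
    (fun k => ?_) (fun k => ae_of_all _ fun y => ?_) (integrable_waveFunction_mul p q).norm
    (ae_of_all _ fun y => by fun_prop)
  · exact (integrable_cexp_mul_ofReal k (integrable_waveFunction_mul p q)).1
  · rw [norm_mul, norm_cexp_I_mul_mul, one_mul, Complex.norm_real]

lemma quadFunction_cexp (φ k : ℝ) (p q : ℕ) :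
    quadFunction φ (fun y => Complex.exp (Complex.I * k * y)) p q
      = Complex.exp (Complex.I * φ * ((p : ℂ) - q)) * charElem p q k := by
  simp only [quadFunction, Matrix.of_apply, quadProj_apply, charElem]
  rw [← integral_const_mul]
  congr 1
  ext y
  ring

/-- The integrand, in `k`, of the matrix elements of the canonical dual at `φ = 0`. -/
def canonicalIntegrand (x : ℝ) (p q : ℕ) (k : ℝ) : ℂ :=
  ((|k| : ℝ) : ℂ) * Complex.exp (-(Complex.I * k * x)) * charElem p q k

lemma canonicalDual_apply (x φ : ℝ) (p q : ℕ) :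
    canonicalDual x φ p q = Complex.exp (Complex.I * φ * ((p : ℂ) - q))
      * ((1 / 4) * ∫ k : ℝ, canonicalIntegrand x p q k) := by
  rw [canonicalDual, Matrix.of_apply, mul_left_comm, ← integral_const_mul
    (Complex.exp (Complex.I * φ * ((p : ℂ) - q)))]
  congr 2
  ext k
  rw [quadFunction_cexp, canonicalIntegrand]
  ring

lemma norm_cexp_neg_I_mul_mul (k x : ℝ) : ‖Complex.exp (-(Complex.I * k * x))‖ = 1 := by
  rw [Complex.norm_exp]; simp

lemma norm_canonicalIntegrand_le (x : ℝ) (p q : ℕ) (k : ℝ) :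
    ‖canonicalIntegrand x p q k‖ ≤ 2 * (4 * ((p : ℝ) + q + 3)) ^ 3 * (1 + k ^ 2)⁻¹ := by
  rw [canonicalIntegrand, norm_mul, norm_mul, norm_cexp_neg_I_mul_mul, mul_one, Complex.norm_real,
    Real.norm_eq_abs, abs_abs, ← div_eq_mul_inv, le_div_iff₀ (by positivity)]
  -- The exponents 1 and 3 are those of |k|(1 + k²) = |k| + |k|³.
  have h1 := abs_pow_mul_norm_charElem_le 1 p q k
  have h3 := abs_pow_mul_norm_charElem_le 3 p q k
  have h0 : (0 : ℝ) ≤ p := p.cast_nonneg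
  have h0' : (0 : ℝ) ≤ q := q.cast_nonneg
  rw [← sq_abs k]
  have e1 : (4 * ((p : ℝ) + q + (1 : ℕ))) ^ 1 ≤ (4 * ((p : ℝ) + q + 3)) ^ 3 := by
    have h4 : (1 : ℝ) ≤ 4 * ((p : ℝ) + q + 3) := by linarith
    calc (4 * ((p : ℝ) + q + (1 : ℕ))) ^ 1 ≤ (4 * ((p : ℝ) + q + 3)) ^ 1 := by
          push_cast; gcongr; norm_num
      _ ≤ _ := pow_le_pow_right₀ h4 (by norm_num)
  push_cast at h3
  calc |k| * ‖charElem p q k‖ * (1 + |k| ^ 2)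
      = |k| ^ 1 * ‖charElem p q k‖ + |k| ^ 3 * ‖charElem p q k‖ := by ring
    _ ≤ _ := by linarith

lemma integrable_canonicalIntegrand (x : ℝ) (p q : ℕ) :
    Integrable (canonicalIntegrand x p q) := by
  refine (integrable_inv_one_add_sq.const_mul (2 * (4 * ((p : ℝ) + q + 3)) ^ 3)).mono'
    ?_ (ae_of_all _ (norm_canonicalIntegrand_le x p q))
  have := continuous_charElem p q
  unfold canonicalIntegrand
  exact (by fun_prop : Continuous _).aestronglyMeasurable

lemma integral_norm_canonicalIntegrand_le (x : ℝ) (p q : ℕ) :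
    ∫ k, ‖canonicalIntegrand x p q k‖ ≤ 2 * (4 * ((p : ℝ) + q + 3)) ^ 3 * Real.pi := by
  rw [← integral_univ_inv_one_add_sq, ← integral_const_mul]
  exact integral_mono (integrable_canonicalIntegrand x p q).norm
    (integrable_inv_one_add_sq.const_mul _) (norm_canonicalIntegrand_le x p q)

/-- The trace `Tr[r^{a†a} K a†²]` before the integration over `k`. -/
lemma hasSum_integral_canonicalIntegrand (x : ℝ) {r : ℝ} (hr0 : 0 < r) (hr1 : r < 1) :
    HasSum (fun s : ℕ => (r : ℂ) ^ s * ((√(((s : ℝ) + 1) * ((s : ℝ) + 2)) : ℂ)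
        * ∫ k : ℝ, canonicalIntegrand x s (s + 2) k))
      (∫ k : ℝ, ((|k| : ℝ) : ℂ) * Complex.exp (-(Complex.I * k * x))
        * (-(k : ℂ) ^ 2 / 4 / (1 - r) ^ 3
          * Complex.exp (-(k : ℂ) ^ 2 * (1 + r) / (8 * (1 - r))))) := by
  set F : ℕ → ℝ → ℂ := fun s k => ((r : ℂ) ^ s * (√(((s : ℝ) + 1) * ((s : ℝ) + 2)) : ℂ))
    * canonicalIntegrand x s (s + 2) k with hF
  have hFi : ∀ s, Integrable (F s) := fun s => (integrable_canonicalIntegrand x s (s + 2)).const_mul _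
  have hFs : Summable fun s => ∫ k, ‖F s k‖ := by
    have hg : Summable fun s : ℕ => ((s : ℝ) ^ 4 * r ^ s) := summable_pow_mul_geometric_of_norm_lt_one 4
      (by rw [Real.norm_eq_abs, abs_of_pos hr0]; exact hr1)
    have hg0 : Summable fun s : ℕ => r ^ s := summable_geometric_of_lt_one hr0.le hr1
    refine Summable.of_nonneg_of_le (fun s => integral_nonneg fun _ => norm_nonneg _)
      (fun s => ?_) ((hg.add hg0).mul_left (10 ^ 7 * Real.pi))
    have h1 : ∀ k, ‖F s k‖ = (r ^ s * √(((s : ℝ) + 1) * ((s : ℝ) + 2)))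
        * ‖canonicalIntegrand x s (s + 2) k‖ := fun k => by
      simp only [hF, norm_mul, norm_pow, Complex.norm_real, Real.norm_eq_abs, abs_of_pos hr0,
        abs_of_nonneg (Real.sqrt_nonneg _)]
    simp only [h1]
    rw [integral_const_mul]
    have h2 := integral_norm_canonicalIntegrand_le x s (s + 2)
    have h3 : √(((s : ℝ) + 1) * ((s : ℝ) + 2)) ≤ (s : ℝ) + 2 := by
      rw [Real.sqrt_le_left (by positivity)]
      nlinarith [(s.cast_nonneg : (0 : ℝ) ≤ s)]
    -- The cubic bound on the integral times the linear factor is quartic in s, hence summable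
    -- against r^s; the constant 10⁷ is merely generous.
    have h4 : ((s : ℝ) + 2) * (2 * (4 * ((s : ℝ) + ((s + 2 : ℕ) : ℝ) + 3)) ^ 3)
        ≤ 10 ^ 7 * ((s : ℝ) ^ 4 + 1) := by
      push_cast
      have h0 : (0 : ℝ) ≤ s := s.cast_nonneg
      have e : 2 * (s : ℝ) + 5 ≤ 5 * (s + 1) := by linarith
      have e2 : ((s : ℝ) + 1) ^ 4 ≤ 8 * ((s : ℝ) ^ 4 + 1) := by
        nlinarith [sq_nonneg ((s : ℝ) ^ 2 - 1), sq_nonneg ((s : ℝ) - 1), sq_nonneg ((s : ℝ) * (s - 1)),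
          sq_nonneg ((s : ℝ) ^ 2 - s)]
      calc ((s : ℝ) + 2) * (2 * (4 * ((s : ℝ) + (s + 2) + 3)) ^ 3)
          = ((s : ℝ) + 2) * (2 * (4 * (2 * (s : ℝ) + 5)) ^ 3) := by ring
        _ ≤ (2 * ((s : ℝ) + 1)) * (2 * (4 * (5 * ((s : ℝ) + 1))) ^ 3) := by
            gcongr
            linarith
        _ = 32000 * ((s : ℝ) + 1) ^ 4 := by ring
        _ ≤ 10 ^ 7 * ((s : ℝ) ^ 4 + 1) := by nlinarith [pow_nonneg h0 4]
    calc r ^ s * √(((s : ℝ) + 1) * ((s : ℝ) + 2)) * ∫ k, ‖canonicalIntegrand x s (s + 2) k‖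
        ≤ r ^ s * ((s : ℝ) + 2)
          * (2 * (4 * ((s : ℝ) + ((s + 2 : ℕ) : ℝ) + 3)) ^ 3 * Real.pi) := by
          gcongr
      _ = r ^ s * Real.pi * (((s : ℝ) + 2)
          * (2 * (4 * ((s : ℝ) + ((s + 2 : ℕ) : ℝ) + 3)) ^ 3)) := by ring
      _ ≤ r ^ s * Real.pi * (10 ^ 7 * ((s : ℝ) ^ 4 + 1)) := by
          have := Real.pi_pos
          gcongr
      _ = _ := by ring
  have h := hasSum_integral_of_summable_integral_norm hFi hFs
  convert! h using 1
  · ext s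
    simp only [hF]
    rw [integral_const_mul, mul_assoc]
  · congr 1
    ext k
    rw [← ((hasSum_charElem_generating k r hr0 hr1).mul_left
      (((|k| : ℝ) : ℂ) * Complex.exp (-(Complex.I * k * x)))).tsum_eq]
    refine tsum_congr fun s => ?_
    simp only [hF, canonicalIntegrand]
    ring

/-- The rescaled form of the regularized trace. -/
def scaledTrace (x r : ℝ) : ℂ :=
  ∫ u : ℝ, ((|u| ^ 3 : ℝ) : ℂ) * Complex.exp (-(Complex.I * (√(1 - r) * u : ℝ) * x))
    * ((Real.exp (-(u ^ 2) * (1 + r) / 8) : ℝ) : ℂ)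

/-- Under k = √(1-r)u the measure, |k| and k² together give (1-r)², against (1-r)³ in the
denominator: the regularized trace has exactly one factor 1/(1-r) more than a convergent integral.
-/
lemma integral_generating_eq_scaledTrace (x : ℝ) {r : ℝ} (hr1 : r < 1) :
    (1 - (r : ℂ)) * ∫ k : ℝ, ((|k| : ℝ) : ℂ) * Complex.exp (-(Complex.I * k * x))
        * (-(k : ℂ) ^ 2 / 4 / (1 - r) ^ 3
          * Complex.exp (-(k : ℂ) ^ 2 * (1 + r) / (8 * (1 - r))))
      = -(1 / 4) * scaledTrace x r := by
  set f : ℝ → ℂ := fun k => ((|k| : ℝ) : ℂ) * Complex.exp (-(Complex.I * k * x))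
        * (-(k : ℂ) ^ 2 / 4 / (1 - r) ^ 3
          * Complex.exp (-(k : ℂ) ^ 2 * (1 + r) / (8 * (1 - r)))) with hf
  set a := √(1 - r) with ha
  have h1r : 0 < 1 - r := by linarith
  have ha0 : 0 < a := Real.sqrt_pos.2 h1r
  have ha2 : a ^ 2 = 1 - r := Real.sq_sqrt h1r.le
  have ha2c : (1 - (r : ℂ)) = (a : ℂ) ^ 2 := by
    rw [← Complex.ofReal_pow, ha2]; push_cast; rfl
  have hac : (a : ℂ) ≠ 0 := by exact_mod_cast ha0.ne'
  have h := Measure.integral_comp_mul_left f a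
  rw [abs_of_pos (inv_pos.2 ha0), Complex.real_smul] at h
  have h' : ∫ k, f k = (a : ℂ) * ∫ u, f (a * u) := by
    rw [h]; push_cast; field_simp
  rw [h', scaledTrace, ← ha, ← integral_const_mul, ← integral_const_mul, ← integral_const_mul]
  congr 1
  ext u
  have e : Complex.exp (-((a * u : ℝ) : ℂ) ^ 2 * (1 + r) / (8 * (1 - r)))
      = ((Real.exp (-(u ^ 2) * (1 + r) / 8) : ℝ) : ℂ) := by
    rw [ha2c]
    push_cast
    congr 1
    field_simp
  have e3 : ((|u| ^ 3 : ℝ) : ℂ) = ((|u| : ℝ) : ℂ) * (u : ℂ) ^ 2 := by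
    rw [← Complex.ofReal_pow, ← sq_abs, ← Complex.ofReal_mul]; congr 1; ring
  simp only [hf]
  rw [e, e3, abs_mul, abs_of_pos ha0, ha2c]
  simp only [Complex.ofReal_mul]
  field_simp

lemma tendsto_scaledTrace (x : ℝ) :
    Tendsto (scaledTrace x) (𝓝[<] 1)
      (𝓝 ((∫ u : ℝ, |u| ^ 3 * Real.exp (-(u ^ 2) * (1 + 1) / 8) : ℝ) : ℂ)) := by
  have e : ((∫ u : ℝ, |u| ^ 3 * Real.exp (-(u ^ 2) * (1 + 1) / 8) : ℝ) : ℂ) = scaledTrace x 1 := by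
    rw [← integral_complex_ofReal]
    simp [scaledTrace]
  rw [e]
  -- The Gaussian at r = 0 dominates those with 0 < r < 1.
  have hb : Integrable fun u : ℝ => |u| ^ 3 * Real.exp (-(1 / 8) * u ^ 2) := by
    have := (integrable_polynomial_mul_gaussian (Polynomial.X ^ 3) (b := 1 / 8) (by norm_num)).abs
    simpa [abs_mul] using this
  refine tendsto_integral_filter_of_dominated_convergence _ ?_ ?_ hb ?_
  · exact Eventually.of_forall fun r => (by fun_prop : Continuous _).aestronglyMeasurable
  · filter_upwards [Ioo_mem_nhdsLT (show (0 : ℝ) < 1 by norm_num)] with r hr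
    refine ae_of_all _ fun u => ?_
    rw [norm_mul, norm_mul, norm_cexp_neg_I_mul_mul, mul_one, Complex.norm_real, Complex.norm_real,
      Real.norm_of_nonneg (by positivity), Real.norm_of_nonneg (by positivity)]
    gcongr
    nlinarith [sq_nonneg u, hr.1, mul_nonneg (sq_nonneg u) hr.1.le]
  · refine ae_of_all _ fun u => ?_
    have : Continuous fun r : ℝ => ((|u| ^ 3 : ℝ) : ℂ)
        * Complex.exp (-(Complex.I * (√(1 - r) * u : ℝ) * x))
        * ((Real.exp (-(u ^ 2) * (1 + r) / 8) : ℝ) : ℂ) := by fun_prop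
    exact (this.tendsto 1).mono_left nhdsWithin_le_nhds

lemma integral_abs_cube_gaussian_pos :
    0 < ∫ u : ℝ, |u| ^ 3 * Real.exp (-(u ^ 2) * (1 + 1) / 8) := by
  have hc : Continuous fun u : ℝ => |u| ^ 3 * Real.exp (-(u ^ 2) * (1 + 1) / 8) := by fun_prop
  refine integral_pos_of_integrable_nonneg_nonzero (x := 1) hc ?_ (fun u => by positivity)
    (by positivity)
  have h := (integrable_polynomial_mul_gaussian (Polynomial.X ^ 3) (b := 1 / 4) (by norm_num)).abs
  refine h.congr (ae_of_all _ fun u => ?_)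
  simp only [Polynomial.eval_pow, Polynomial.eval_X, abs_mul, abs_pow, Real.abs_exp]
  congr 2
  ring

lemma hasSum_weighted_trace_canonicalDual (x φ : ℝ) {r : ℝ} (hr0 : 0 < r) (hr1 : r < 1) :
    HasSum (fun p : ℕ × ℕ => (r : ℂ) ^ p.1
        * ((canonicalDual x φ).conjTranspose p.1 p.2 * fockMatrix (annihilation ^ 2) p.2 p.1))
      ((r : ℂ) ^ 2 * Complex.exp (Complex.I * φ * 2) * (1 / 4) * (starRingEnd ℂ)
        (∫ k : ℝ, ((|k| : ℝ) : ℂ) * Complex.exp (-(Complex.I * k * x))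
        * (-(k : ℂ) ^ 2 / 4 / (1 - r) ^ 3
          * Complex.exp (-(k : ℂ) ^ 2 * (1 + r) / (8 * (1 - r)))))) := by
  have h0 : (annihilation ^ 2 : Module.End ℂ FockSpan) = creation ^ 0 * annihilation ^ 2 := by
    rw [pow_zero, one_mul]
  rw [h0, hasSum_weighted_trace_moment_iff]
  have h := ((Complex.hasSum_conj'.2 (hasSum_integral_canonicalIntegrand x hr0 hr1))).mul_left
    ((r : ℂ) ^ 2 * Complex.exp (Complex.I * φ * 2) * (1 / 4))
  convert! h using 1
  ext s
  have e1 : √((0 + s).factorial : ℝ) * √((2 + s).factorial : ℝ) / s.factorial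
      = √(((s : ℝ) + 1) * ((s : ℝ) + 2)) := by
    have e2 : √((2 + s).factorial : ℝ)
        = √(((s : ℝ) + 1) * ((s : ℝ) + 2)) * √(s.factorial : ℝ) := by
      rw [← Real.sqrt_mul (by positivity), add_comm 2 s, Nat.factorial_succ, Nat.factorial_succ]
      congr 1
      push_cast
      ring
    have e3 : √(s.factorial : ℝ) * √(s.factorial : ℝ) = s.factorial :=
      Real.mul_self_sqrt (by positivity)
    have e4 : (s.factorial : ℝ) ≠ 0 := by positivity
    rw [e2, zero_add, div_eq_iff e4]
    linear_combination √(((s : ℝ) + 1) * ((s : ℝ) + 2)) * e3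
  have e5 : (starRingEnd ℂ) (Complex.exp (Complex.I * φ * (((0 + s : ℕ) : ℂ) - ((2 + s : ℕ) : ℂ))))
      = Complex.exp (Complex.I * φ * 2) := by
    rw [← Complex.exp_conj]
    congr 1
    simp only [map_mul, map_sub, Complex.conj_I, Complex.conj_ofReal, map_natCast]
    push_cast
    ring
  rw [e1, Matrix.conjTranspose_apply, canonicalDual_apply]
  simp only [← starRingEnd_apply, map_mul, map_pow, Complex.conj_ofReal, e5]
  simp only [map_div₀, map_one, map_ofNat, zero_add, add_comm 2 s]
  ring

/-- A finite Abel limit would force (1-r) times the trace to 0, whereas it tends to a nonzero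
multiple of ∫|u|³e^{-u²/4}du > 0. -/
lemma not_hasAbelTrace_canonicalDual (x φ : ℝ) (L : ℂ) :
    ¬ HasAbelTrace (canonicalDual x φ).conjTranspose (fockMatrix (annihilation ^ 2)) L := by
  rintro ⟨-, hlim⟩
  have h1 : Tendsto (fun r : ℝ => 1 - (r : ℂ)) (𝓝[<] 1) (𝓝 0) := by
    have : Continuous fun r : ℝ => 1 - (r : ℂ) := by fun_prop
    simpa using (this.tendsto 1).mono_left nhdsWithin_le_nhds
  have h2 := h1.mul hlim
  rw [zero_mul] at h2
  have h3 : Tendsto (fun r : ℝ => (r : ℂ) ^ 2 * Complex.exp (Complex.I * φ * 2) * (1 / 4)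
      * (starRingEnd ℂ) (-(1 / 4) * scaledTrace x r)) (𝓝[<] 1)
      (𝓝 (((1 : ℝ) : ℂ) ^ 2 * Complex.exp (Complex.I * φ * 2) * (1 / 4)
        * (starRingEnd ℂ) (-(1 / 4)
          * ((∫ u : ℝ, |u| ^ 3 * Real.exp (-(u ^ 2) * (1 + 1) / 8) : ℝ) : ℂ)))) := by
    refine Tendsto.mul ?_ ((Complex.continuous_conj.tendsto _).comp
      ((tendsto_scaledTrace x).const_mul _))
    have : Continuous fun r : ℝ => (r : ℂ) ^ 2 * Complex.exp (Complex.I * φ * 2) * (1 / 4) := by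
      fun_prop
    exact (this.tendsto 1).mono_left nhdsWithin_le_nhds
  have h4 := tendsto_nhds_unique (h3.congr' ?_) h2
  · have hpos := integral_abs_cube_gaussian_pos
    have hne : ((∫ u : ℝ, |u| ^ 3 * Real.exp (-(u ^ 2) * (1 + 1) / 8) : ℝ) : ℂ) ≠ 0 := by
      exact_mod_cast hpos.ne'
    rw [map_mul, Complex.conj_ofReal] at h4
    simp only [mul_eq_zero, Complex.exp_ne_zero, hne] at h4
    norm_num at h4
  · filter_upwards [Ioo_mem_nhdsLT (show (0 : ℝ) < 1 by norm_num)] with r hr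
    rw [(hasSum_weighted_trace_canonicalDual x φ hr.1 hr.2).tsum_eq,
      ← integral_generating_eq_scaledTrace x hr.2]
    simp only [map_mul, map_sub, map_one, Complex.conj_ofReal]
    ring

/-- No matrix element needs comparing: the two are told apart by their Abel traces with a². -/
lemma quadDual_ne_canonicalDual (x φ : ℝ) : quadDual x φ ≠ canonicalDual x φ := fun h => by
  have h1 := hasAbelTrace_quadDual x φ 0 2
  rw [h, pow_zero, one_mul] at h1
  exact not_hasAbelTrace_canonicalDual x φ _ h1

end

theorem mainTheorem6 :
    ∃ G : ℝ → ℝ → Matrix ℕ ℕ ℂ,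
      -- covariance: `G(x,φ) = e^{iφ a†a} G(x,0) e^{-iφ a†a}`
      (∀ x φ : ℝ, G x φ = phaseRotate φ (G x 0)) ∧
      -- expansion of `G†(x,0)` over the dual set of the moments
      (∀ (x : ℝ) (i j : ℕ),
        HasSum (fun kl : ℕ × ℕ => momentDual kl.1 kl.2 i j * (momentCoeff kl.1 kl.2 x : ℂ))
          ((G x 0).conjTranspose i j)) ∧
      -- `Tr[G†(x,φ) a†ⁿ aᵐ]`, with the expansion of `G†` traced term by term
      (∀ (x φ : ℝ) (n m : ℕ),
        HasSum (fun kl : ℕ × ℕ => (momentCoeff kl.1 kl.2 x : ℂ)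
            * fockTrace (phaseRotate φ (momentDual kl.1 kl.2))
                (fockMatrix (creation ^ n * annihilation ^ m)))
          (momentEstimator n m x φ)) ∧
      -- the same trace, computed from the operator `G†(x,φ)` itself
      (∀ (x φ : ℝ) (n m : ℕ),
        HasAbelTrace (G x φ).conjTranspose (fockMatrix (creation ^ n * annihilation ^ m))
          (momentEstimator n m x φ)) ∧
      -- Richter's expansion of `a†ⁿ aᵐ`, over the spectral densities and over `H_{n+m}(√2 X_φ)`
      (∀ n m p q : ℕ,
        (∀ φ : ℝ,
          Integrable (fun x : ℝ => momentEstimator n m x φ * quadProj x φ p q) ∧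
          quadFunction φ (fun x => momentEstimator n m x φ) p q
            = fockMatrix (richterOperator n m φ) p q) ∧
        IntervalIntegrable (fun φ : ℝ => fockMatrix (richterOperator n m φ) p q)
          volume 0 Real.pi ∧
        (1 / (Real.pi : ℂ)) * ∫ φ in (0 : ℝ)..Real.pi, fockMatrix (richterOperator n m φ) p q
          = fockMatrix (creation ^ n * annihilation ^ m) p q) ∧
      -- duality: `∫ dφ/π ∫ dx |δ(X_φ - x)⟩⟩⟨⟨G(x,φ)| = I ⊗ I`
      (∀ p q i j : ℕ,
        Integrable (fun z : ℝ × ℝ => quadProj z.2 z.1 p q * (starRingEnd ℂ) (G z.2 z.1 i j))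
          ((volume.restrict (Set.Ioc (0 : ℝ) Real.pi)).prod volume) ∧
        (1 / (Real.pi : ℂ)) * ∫ φ in (0 : ℝ)..Real.pi, ∫ x : ℝ,
            quadProj x φ p q * (starRingEnd ℂ) (G x φ i j)
          = if p = i ∧ q = j then 1 else 0) ∧
      -- `G(x,φ)` is not the canonical dual, which is divergent on an unbounded operator
      (∀ x φ : ℝ, G x φ ≠ canonicalDual x φ) ∧
      (∀ (x φ : ℝ) (L : ℂ),
        ¬ HasAbelTrace (canonicalDual x φ).conjTranspose (fockMatrix (annihilation ^ 2)) L) ∧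
      -- pattern functions `Tr[G†(x,φ) |i⟩⟨j|]`
      (∀ (x φ : ℝ) (i j : ℕ),
        HasSum (fun t : ℕ =>
            (((-1 : ℝ) ^ t / ((t.factorial : ℝ) * √((i.factorial : ℝ) * (j.factorial : ℝ)))
              * momentCoeff (j + t) (i + t) x : ℝ) : ℂ)
            * Complex.exp (Complex.I * φ * ((j : ℂ) - (i : ℂ))))
          (fockTrace (G x φ).conjTranspose (Matrix.single i j 1))) ∧
      -- the vacuum pattern function
      (∀ x φ : ℝ,
        HasSum (fun k : ℕ =>
            (((-1 / 2 : ℝ) ^ k * ((k.factorial : ℝ) / ((2 * k).factorial : ℝ))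
              * (hermiteH (2 * k)).eval (√2 * x) : ℝ) : ℂ))
          (fockTrace (G x φ).conjTranspose (Matrix.single 0 0 1))) := by
  exact ⟨quadDual, quadDual_eq_phaseRotate, hasSum_momentDual, hasSum_fockTrace_momentDual,
    hasAbelTrace_quadDual,
    fun n m p q => ⟨fun φ => ⟨integrable_momentEstimator_mul_quadProj n m p q φ,
        quadFunction_momentEstimator n m p q φ⟩,
      (continuous_fockMatrix_richterOperator n m p q).intervalIntegrable _ _,
      integral_fockMatrix_richterOperator n m p q⟩,
    fun p q i j => ⟨integrable_quadProj_mul_conj_quadDual p q i j,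
      integral_quadProj_mul_conj_quadDual p q i j⟩,
    quadDual_ne_canonicalDual, not_hasAbelTrace_canonicalDual, hasSum_patternFunction,
    hasSum_vacuumPatternFunction⟩
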